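/- Let $K/k$ be a field extension and $A$ a (finite-dimensional) central simple $K$-algebra. Definitions. For a field extension $L/k$, let $\mathrm{Rad}_k(L)$ be the group of all $x\in L^\times$ of finite order modulo $k^\times$; $L/k$ is called radical if $L=k(\mathrm{Rad}_k(L))$. A central simple $K$-algebra $B$ is radical over $k$ if it is a crossed product $B=\bigoplus_{\sigma\in \mathrm{Gal}(L/K)}Lu_\sigma$ with $u_\sigma x=\sigma(x)u_\sigma$ $(x\in L)$ and $u_\sigma u_\tau=t(\sigma,\tau)u_{\sigma\tau}$, where $L/K$ is a finite Galois extension such that $L/k$ is radical and $t$ is a $2$-cocycle with all values in $\mathrm{Rad}_k(L)$. It is radical abelian over $k$ if moreover $L/K$ can be chosen with $\mathrm{Gal}(L/K)$ abelian. A group $\Gamma$ is supersolvable if it has a finite series $1=N_0\le N_1\le\dots\le N_n=\Gamma$ of normal subgroups of $\Gamma$ with every $N_{i+1}/N_i$ cyclic. A subgroup $\Gamma\le A^\times$ is finite modulo $k^\times$ if $[\Gamma:\Gamma\cap k^\times]<\infty$. (a) If $K/k$ is finite and $A$ is radical over $k$, then $A$ is generated as a $k$-algebra by a supersolvable group of units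 that is finite modulo $k^\times$. (b) If $A$ is generated as a $k$-algebra by a supersolvable group of units that is finite modulo $k^\times$, then there are $n\ge 1$ and a central simple $K$-algebra $C$, radical abelian over $k$, such that $A\cong M_n(C)$ as $K$-algebras. -/

import Mathlib

universe u v w

/-- `G` is supersolvable: there is a finite series `1 = N 0 ≤ N 1 ≤ ... ≤ N n = G` of subgroups,
each normal in the whole group `G`, with all the quotients `N (i + 1) / N i` cyclic
(finite or infinite). -/
def IsSupersolvable (G : Type*) [Group G] : Prop :=
  ∃ (n : ℕ) (N : ℕ → Subgroup G) (_ : ∀ i, (N i).Normal),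
    N 0 = ⊥ ∧ N n = ⊤ ∧
      ∀ i < n, N i ≤ N (i + 1) ∧ IsCyclic (N (i + 1) ⧸ (N i).subgroupOf (N (i + 1)))

/-- The image of `k^×` in the group of units of a `k`-algebra `A`. -/
def scalarUnits (k A : Type*) [Field k] [Ring A] [Algebra k A] : Subgroup Aˣ :=
  (Units.map (algebraMap k A : k →* A)).range

/-- `A` is generated, as a `k`-algebra, by a supersolvable group of units `Γ` which is finite
modulo `k^×`, i.e. `[Γ : Γ ∩ k^×] < ∞`. -/
def IsGeneratedBySupersolvable (k A : Type*) [Field k] [Ring A] [Algebra k A] : Prop :=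
  ∃ Γ : Subgroup Aˣ, IsSupersolvable Γ ∧ ((scalarUnits k A).subgroupOf Γ).FiniteIndex ∧
    Algebra.adjoin k (Units.val '' (Γ : Set Aˣ)) = ⊤

/-- `Rad_k(L)`: the group of units of `L` that are of finite order modulo `k^×`. -/
def radGroup (k L : Type*) [Field k] [Field L] [Algebra k L] : Subgroup Lˣ where
  carrier := {x | ∃ n : ℕ, 0 < n ∧ x ^ n ∈ scalarUnits k L}
  one_mem' := ⟨1, one_pos, by simp⟩
  mul_mem' := by
    rintro x y ⟨m, hm, hx⟩ ⟨n, hn, hy⟩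
    refine ⟨m * n, Nat.mul_pos hm hn, ?_⟩
    rw [mul_pow, pow_mul, mul_comm m n, pow_mul y]
    exact mul_mem (pow_mem hx n) (pow_mem hy m)
  inv_mem' := by
    rintro x ⟨m, hm, hx⟩
    exact ⟨m, hm, by rw [inv_pow]; exact inv_mem hx⟩

/-- `L/k` is a radical extension: `L = k(Rad_k(L))`. -/
def IsRadicalExtension (k L : Type*) [Field k] [Field L] [Algebra k L] : Prop :=
  IntermediateField.adjoin k (Units.val '' (radGroup k L : Set Lˣ)) = ⊤

/-- The `K`-algebra `A` is the crossed product `(L/K, t) = ⊕_σ L u_σ` of the finite Galois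
extension `L/K` and the 2-cocycle `t`: it contains `L` (through `ι`) and units `u_σ`, one for each
`σ ∈ Gal(L/K)`, which form a basis of `A` as a left `L`-vector space and satisfy
`u_σ x = σ(x) u_σ` for `x ∈ L` and `u_σ u_τ = t(σ, τ) u_{στ}`. -/
def IsCrossedProduct (K L A : Type*) [Field K] [Field L] [Algebra K L] [FiniteDimensional K L]
    [Ring A] [Algebra K A] (t : (L ≃ₐ[K] L) × (L ≃ₐ[K] L) → Lˣ) : Prop :=
  IsGalois K L ∧ groupCohomology.IsMulCocycle₂ t ∧
    ∃ (ι : L →ₐ[K] A) (u : (L ≃ₐ[K] L) → Aˣ),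
      Function.Bijective (fun c : (L ≃ₐ[K] L) → L => ∑ σ, ι (c σ) * (u σ : A)) ∧
      (∀ σ x, (u σ : A) * ι x = ι (σ x) * (u σ : A)) ∧
      (∀ σ τ, (u σ : A) * (u τ : A) = ι (t (σ, τ) : L) * (u (σ * τ) : A))

/-- `A` is radical over `k`: it is a crossed product `(L/K, α)` where `L/k` is radical and `α` is
represented by a 2-cocycle with values in `Rad_k(L)`. As `L` embeds into `A`, it is no restriction
to take `L` in the universe of `A`. -/
def IsRadicalOver (k : Type u) (K : Type v) (A : Type w) [Field k] [Field K] [Algebra k K]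
    [Ring A] [Algebra K A] : Prop :=
  ∃ (L : Type w) (_ : Field L) (_ : Algebra K L) (_ : Algebra k L) (_ : IsScalarTower k K L)
    (_ : FiniteDimensional K L) (t : (L ≃ₐ[K] L) × (L ≃ₐ[K] L) → Lˣ),
    IsRadicalExtension k L ∧ (∀ p, t p ∈ radGroup k L) ∧ IsCrossedProduct K L A t

/-- `A` is radical abelian over `k`: as before, with `L/K` an abelian extension. -/
def IsRadicalAbelianOver (k : Type u) (K : Type v) (A : Type w) [Field k] [Field K] [Algebra k K]
    [Ring A] [Algebra K A] : Prop :=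
  ∃ (L : Type w) (_ : Field L) (_ : Algebra K L) (_ : Algebra k L) (_ : IsScalarTower k K L)
    (_ : FiniteDimensional K L) (t : (L ≃ₐ[K] L) × (L ≃ₐ[K] L) → Lˣ),
    IsRadicalExtension k L ∧ (∀ p, t p ∈ radGroup k L) ∧ IsCrossedProduct K L A t ∧
      ∀ σ τ : L ≃ₐ[K] L, σ * τ = τ * σ

/-! Part (a). Write `A = ⊕ L u_σ`. Since `L/k` is finite, finitely many radicals, the values of `t`
among them, span `L` over `k`. The quotients `σ(s)/s` of these radicals are roots of unity; they
generate a finite, hence cyclic, Galois-stable group `⟨ζ⟩`. The group `M` generated by `ζ` and the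
chosen radicals is Galois-stable, so `Γ = {m u_σ}` is a group, and it generates `A`. It is finite
modulo `k^×` because `M` is a finitely generated abelian group, torsion modulo `k^×`. It is
supersolvable (`isSupersolvable_crossedProductGroup`): conjugation preserves `⟨ζ⟩`, changes a
radical `s` by a power of `ζ`, sends `u_σ` with `σ(ζ) = ζ` into `M u_σ^j` by Kummer theory
(`conj_eq_zpow_of_fixes_root`), and changes an arbitrary `u_σ` by an element acting trivially on
`ζ`, since automorphisms act on `⟨ζ⟩` by commuting power maps.

Part (b) is by induction on the dimension of `A`. Suppose first that some abelian normal subgroup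
`N` of `Γ` generates a `K`-algebra `B` that is not a field. As `Γ` normalizes `B` and spans the
simple algebra `A`, `B` is reduced, so it has a minimal idempotent `e ≠ 1`. The `Γ`-conjugates of
`e` are orthogonal and their sum is central, hence equal to `1`. So `A` is a matrix algebra over
`eAe`, which is generated by the image of the stabilizer of `e`
(`exists_matrix_corner_of_not_isField`), and induction applies.

Otherwise all these algebras are fields. By Schur's theorem the commutator subgroup `Γ'` is finite.
A maximal abelian normal subgroup of `Γ` inside `Γ'` is then a finite subgroup of a field, hence
cyclic; `Γ'` centralizes it, and supersolvability makes it self-centralizing in `Γ'`, so it equals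
`Γ'` (`commutator_comm_of_fields`). Thus `Γ'` lies in an abelian normal subgroup `N` that is
self-centralizing in `Γ`. Conjugation identifies `Γ/N` with the Galois group of `L = K[N]` over `K`,
which is abelian since `Γ' ≤ N`; lifts of its elements to `Γ` form the crossed product basis, with
cocycle values in `N` (`exists_crossedProduct_of_self_centralizing`). -/

open scoped commutatorElement

/-! ### Supersolvable groups, their abelian normal subgroups and commutators. -/

section Supersolvable

variable {G : Type*} [Group G]

/-- Elementwise form of cyclicity, which spares later arguments the nested quotient. -/
theorem isCyclic_quotient_subgroupOf_iff {N M : Subgroup G} [N.Normal] :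
    IsCyclic (M ⧸ N.subgroupOf M) ↔ ∃ g ∈ M, ∀ x ∈ M, ∃ m : ℤ, (g ^ m)⁻¹ * x ∈ N := by
  constructor
  · rintro ⟨q, hq⟩
    obtain ⟨g, rfl⟩ := QuotientGroup.mk_surjective q
    refine ⟨g, g.2, fun x hx => ?_⟩
    obtain ⟨m, hm⟩ := hq (QuotientGroup.mk ⟨x, hx⟩)
    refine ⟨m, ?_⟩
    have h : ((g ^ m : M) : M ⧸ N.subgroupOf M) = QuotientGroup.mk ⟨x, hx⟩ := hm
    rw [QuotientGroup.eq, Subgroup.mem_subgroupOf] at h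
    exact h
  · rintro ⟨g, hg, h⟩
    refine ⟨⟨QuotientGroup.mk ⟨g, hg⟩, fun q => ?_⟩⟩
    obtain ⟨x, rfl⟩ := QuotientGroup.mk_surjective q
    obtain ⟨m, hm⟩ := h x x.2
    refine ⟨m, ?_⟩
    change (((⟨g, hg⟩ : M) ^ m : M) : M ⧸ N.subgroupOf M) = QuotientGroup.mk x
    rw [QuotientGroup.eq, Subgroup.mem_subgroupOf]
    exact hm

theorem exists_zpow_eq_of_isCyclic {C : Type*} [Group C] [IsCyclic C] (f : G →* C) :
    ∃ g, ∀ x, ∃ m : ℤ, f x = f g ^ m := by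
  obtain ⟨⟨_, g, rfl⟩, hg⟩ := IsCyclic.exists_generator (α := f.range)
  refine ⟨g, fun x => ?_⟩
  obtain ⟨m, hm⟩ := hg ⟨f x, x, rfl⟩
  exact ⟨m, (congrArg Subtype.val hm).symm⟩

/-- The homomorphism from `M.subgroupOf H` to the quotient `M / N`. -/
def subgroupOfToQuotient (H N M : Subgroup G) [N.Normal] :
    M.subgroupOf H →* M ⧸ N.subgroupOf M :=
  (QuotientGroup.mk' _).comp
    ((H.subtype.comp (M.subgroupOf H).subtype).codRestrict M fun x => x.2)

theorem subgroupOfToQuotient_eq_one_iff (H N M : Subgroup G) [N.Normal] (x : M.subgroupOf H) :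
    subgroupOfToQuotient H N M x = 1 ↔ ((x : H) : G) ∈ N := by
  refine (QuotientGroup.eq_one_iff _).trans ?_
  rw [Subgroup.mem_subgroupOf]
  rfl

theorem IsSupersolvable.subgroup (hG : IsSupersolvable G) (H : Subgroup G) :
    IsSupersolvable H := by
  obtain ⟨n, N, hN, h0, hn, h⟩ := hG
  refine ⟨n, fun i => (N i).subgroupOf H, fun i => inferInstance, ?_, ?_, fun i hi => ⟨?_, ?_⟩⟩
  · simp [h0]
  · simp [hn]
  · exact fun x hx => (h i hi).1 hx
  · have := (h i hi).2
    obtain ⟨g, hg⟩ := exists_zpow_eq_of_isCyclic (subgroupOfToQuotient H (N i) (N (i + 1)))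
    rw [isCyclic_quotient_subgroupOf_iff]
    refine ⟨g, g.2, fun x hx => ?_⟩
    obtain ⟨m, hm⟩ := hg ⟨x, hx⟩
    refine ⟨m, ?_⟩
    have h1 : subgroupOfToQuotient H (N i) (N (i + 1)) ((g ^ m)⁻¹ * ⟨x, hx⟩) = 1 := by
      rw [map_mul, map_inv, map_zpow, hm, inv_mul_cancel]
    exact (subgroupOfToQuotient_eq_one_iff _ _ _ _).1 h1

theorem IsSupersolvable.of_surjective {G' : Type*} [Group G'] (hG : IsSupersolvable G)
    (f : G →* G') (hf : Function.Surjective f) : IsSupersolvable G' := by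
  obtain ⟨n, N, hN, h0, hn, h⟩ := hG
  have hN' : ∀ i, ((N i).map f).Normal := fun i => (hN i).map f hf
  refine ⟨n, fun i => (N i).map f, hN', ?_, ?_, fun i hi => ⟨?_, ?_⟩⟩
  · simp [h0]
  · simp [hn, ← MonoidHom.range_eq_map, MonoidHom.range_eq_top.2 hf]
  · exact Subgroup.map_mono (h i hi).1
  · obtain ⟨g, hg, hg'⟩ := isCyclic_quotient_subgroupOf_iff.1 (h i hi).2
    rw [isCyclic_quotient_subgroupOf_iff]
    refine ⟨f g, ⟨g, hg, rfl⟩, ?_⟩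
    rintro _ ⟨x, hx, rfl⟩
    obtain ⟨m, hm⟩ := hg' x hx
    exact ⟨m, _, hm, by simp⟩

/-- In a supersolvable group, an abelian normal subgroup contained in a normal subgroup `D` is
contained in one that is its own centralizer in `D`. -/
theorem IsSupersolvable.exists_self_centralizing (hG : IsSupersolvable G) {D N₀ : Subgroup G}
    (hD : D.Normal) (hN₀ : N₀.Normal) (hN₀D : N₀ ≤ D)
    (hcomm : ∀ x ∈ N₀, ∀ y ∈ N₀, x * y = y * x) :
    ∃ N : Subgroup G, N.Normal ∧ N₀ ≤ N ∧ N ≤ D ∧ (∀ x ∈ N, ∀ y ∈ N, x * y = y * x) ∧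
      ∀ x ∈ D, (∀ y ∈ N, x * y = y * x) → x ∈ N := by
  let P : Set (Subgroup G) :=
    {N | N.Normal ∧ N₀ ≤ N ∧ N ≤ D ∧ ∀ x ∈ N, ∀ y ∈ N, x * y = y * x}
  obtain ⟨N, -, hNmax⟩ := zorn_le_nonempty₀ P (by
    intro c hcP hc M hM
    have hne : c.Nonempty := ⟨M, hM⟩
    have hdir : DirectedOn (· ≤ ·) c := hc.directedOn
    refine ⟨sSup c, ⟨⟨?_⟩, ?_, ?_, ?_⟩, fun _ => le_sSup⟩
    · intro x hx g
      rw [Subgroup.mem_sSup_of_directedOn hne hdir] at hx ⊢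
      obtain ⟨N, hN, hx⟩ := hx
      exact ⟨N, hN, (hcP hN).1.conj_mem x hx g⟩
    · exact (hcP hM).2.1.trans (le_sSup hM)
    · exact sSup_le fun N hN => (hcP hN).2.2.1
    · intro x hx y hy
      rw [Subgroup.mem_sSup_of_directedOn hne hdir] at hx hy
      obtain ⟨N, hN, hx⟩ := hx
      obtain ⟨N', hN', hy⟩ := hy
      rcases hc.total hN hN' with hle | hle
      · exact (hcP hN').2.2.2 x (hle hx) y hy
      · exact (hcP hN).2.2.2 x hx y (hle hy)) N₀ ⟨hN₀, le_rfl, hN₀D, hcomm⟩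
  obtain ⟨hNn, hN₀N, hND, hNc⟩ := hNmax.prop
  refine ⟨N, hNn, hN₀N, hND, hNc, ?_⟩
  by_contra! hcon
  obtain ⟨n, S, hS, hS0, hSn, hSc⟩ := hG
  set C := Subgroup.centralizer (N : Set G) ⊓ D with hC
  have hCmem : ∀ {x}, x ∈ C → ∀ y ∈ N, x * y = y * x := fun hx y hy =>
    (Subgroup.mem_centralizer_iff.1 hx.1 y hy).symm
  have hex : ∃ i, ¬ C ⊓ S i ≤ N := by
    obtain ⟨x, hx, hxc, hxN⟩ := hcon
    refine ⟨n, fun hle => hxN (hle ⟨⟨Subgroup.mem_centralizer_iff.2 fun y hy =>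
      (hxc y hy).symm, hx⟩, by simp [hSn]⟩)⟩
  classical
  -- `i + 1` is the first index at which the series, cut down to the centralizer `C` of `N` in `D`,
  -- leaves `N`.
  obtain ⟨i, hi, hmin⟩ : ∃ i, C ⊓ S i ≤ N ∧ ¬ C ⊓ S (i + 1) ≤ N ∧ i < n := by
    have hfind := Nat.find_spec hex
    have hle : Nat.find hex ≤ n := by
      apply Nat.find_min' hex
      obtain ⟨x, hx, hxc, hxN⟩ := hcon
      exact fun hle => hxN (hle ⟨⟨Subgroup.mem_centralizer_iff.2 fun y hy =>
        (hxc y hy).symm, hx⟩, by simp [hSn]⟩)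
    have hpos : Nat.find hex ≠ 0 := by
      intro h0
      rw [h0, hS0] at hfind
      exact hfind (by simp)
    obtain ⟨i, hi⟩ := Nat.exists_eq_succ_of_ne_zero hpos
    refine ⟨i, not_not.1 (Nat.find_min hex (by omega)), ?_, by omega⟩
    rw [hi] at hfind
    exact hfind
  obtain ⟨hnot, hin⟩ := hmin
  have hcyc := (hSc i hin).2
  have hCn : C.Normal := by
    have : (Subgroup.centralizer (N : Set G)).Normal := inferInstance
    exact Subgroup.normal_inf_normal _ _
  set E := C ⊓ S (i + 1) with hE
  have hEn : E.Normal := Subgroup.normal_inf_normal _ _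
  have hEc : ∀ x ∈ E, ∀ y ∈ E, x * y = y * x := by
    intro x hx y hy
    -- `E` maps to the cyclic group `S (i + 1) / S i` with kernel inside `N`, which `E` centralizes.
    -- A group that is cyclic modulo a central subgroup is abelian, so `N ⊔ E` contradicts
    -- maximality.
    have key := (MonoidHom.isMulCommutative_of_isCyclic_of_ker_le_center
      ((subgroupOfToQuotient ⊤ (S i) (S (i + 1))).comp
        ((MonoidHom.codRestrict
          (MonoidHom.codRestrict E.subtype ⊤ (fun _ => Subgroup.mem_top _)) _ fun x => x.2.2)))
      (by
        intro z hz
        have hz' : (z : G) ∈ S i := (subgroupOfToQuotient_eq_one_iff _ _ _ _).1 hz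
        have hzN : (z : G) ∈ N := hi ⟨z.2.1, hz'⟩
        rw [Subgroup.mem_center_iff]
        intro g
        exact Subtype.ext (hCmem g.2.1 z hzN))).is_comm.comm ⟨x, hx⟩ ⟨y, hy⟩
    exact congrArg Subtype.val key
  have hmem : N ⊔ E ∈ P := by
    refine ⟨Subgroup.sup_normal N E, hN₀N.trans le_sup_left,
      sup_le hND (inf_le_left.trans inf_le_right), ?_⟩
    intro x hx y hy
    obtain ⟨a, ha, b, hb, rfl⟩ := Subgroup.mem_sup_of_normal_left.1 hx
    obtain ⟨c, hc, d, hd, rfl⟩ := Subgroup.mem_sup_of_normal_left.1 hy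
    have h1 := hNc a ha c hc
    have h2 := hCmem hb.1 c hc
    have h3 := hCmem hd.1 a ha
    have h4 := hEc b hb d hd
    calc a * b * (c * d) = a * (b * c) * d := by group
      _ = (a * c) * (b * d) := by rw [h2]; group
      _ = c * (a * d) * b := by rw [h1, h4]; group
      _ = c * d * (a * b) := by rw [← h3]; group
  exact hnot (le_sup_right.trans (hNmax.le_of_ge hmem le_sup_left))

/-- A commutator depends only on the cosets of its entries modulo `Z`, so there are finitely many
commutators; Schur's theorem does the rest. -/
theorem finite_commutator_of_finiteIndex_le_center {Z : Subgroup G} (hZ : Z ≤ Subgroup.center G)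
    [Z.FiniteIndex] : Finite (commutator G) := by
  have : Finite (commutatorSet G) := by
    let f : (G ⧸ Z) × (G ⧸ Z) → G := fun p => ⁅p.1.out, p.2.out⁆
    have : commutatorSet G ⊆ Set.range f := by
      rintro _ ⟨a, b, rfl⟩
      refine ⟨(a, b), ?_⟩
      obtain ⟨⟨z, hz⟩, h1⟩ := QuotientGroup.mk_out_eq_mul Z a
      obtain ⟨⟨z', hz'⟩, h2⟩ := QuotientGroup.mk_out_eq_mul Z b
      simp only [f, h1, h2]
      have c1 := fun g => (Subgroup.mem_center_iff.1 (hZ hz) g)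
      have c2 := fun g => (Subgroup.mem_center_iff.1 (hZ hz') g)
      rw [commutatorElement_def, commutatorElement_def, mul_inv_rev, mul_inv_rev]
      calc a * z * (b * z') * (z⁻¹ * a⁻¹) * (z'⁻¹ * b⁻¹)
          = a * (z * (b * z')) * z⁻¹ * a⁻¹ * z'⁻¹ * b⁻¹ := by group
        _ = a * b * (z' * a⁻¹) * z'⁻¹ * b⁻¹ := by rw [← c1]; group
        _ = a * b * a⁻¹ * b⁻¹ := by rw [← c2]; group
    exact (Set.finite_range f).subset this
  infer_instance

/-- Elements of `commutator G` centralize every cyclic normal subgroup. -/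
theorem commutator_commute_of_isCyclic {N : Subgroup G} [hN : N.Normal] [IsCyclic N] {x y : G}
    (hx : x ∈ commutator G) (hy : y ∈ N) : x * y = y * x := by
  obtain ⟨⟨g, hg⟩, hgen⟩ := IsCyclic.exists_generator (α := N)
  have hgen' : ∀ y ∈ N, ∃ m : ℤ, g ^ m = y := fun y hy => by
    obtain ⟨m, hm⟩ := hgen ⟨y, hy⟩
    exact ⟨m, congrArg Subtype.val hm⟩
  have hconj : ∀ a : G, ∃ m : ℤ, a * g * a⁻¹ = g ^ m := fun a => by
    obtain ⟨m, hm⟩ := hgen' _ (hN.conj_mem g hg a)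
    exact ⟨m, hm.symm⟩
  have hle : commutator G ≤ Subgroup.centralizer {g} := by
    rw [commutator_eq_closure, Subgroup.closure_le]
    rintro _ ⟨a, b, rfl⟩
    rw [SetLike.mem_coe, Subgroup.mem_centralizer_singleton_iff]
    obtain ⟨m, hm⟩ := hconj a⁻¹
    obtain ⟨n, hn⟩ := hconj b⁻¹
    -- Conjugations act on the cyclic group as power maps, and these commute.
    have h1 : (a⁻¹ * b⁻¹) * g * (a⁻¹ * b⁻¹)⁻¹ = g ^ (m * n) := by
      calc (a⁻¹ * b⁻¹) * g * (a⁻¹ * b⁻¹)⁻¹ = a⁻¹ * (b⁻¹ * g * b⁻¹⁻¹) * a⁻¹⁻¹ := by group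
        _ = g ^ (m * n) := by rw [hn, ← conj_zpow, hm, zpow_mul]
    have h2 : (b⁻¹ * a⁻¹) * g * (b⁻¹ * a⁻¹)⁻¹ = g ^ (m * n) := by
      calc (b⁻¹ * a⁻¹) * g * (b⁻¹ * a⁻¹)⁻¹ = b⁻¹ * (a⁻¹ * g * a⁻¹⁻¹) * b⁻¹⁻¹ := by group
        _ = g ^ (m * n) := by rw [hm, ← conj_zpow, hn, ← zpow_mul, mul_comm]
    calc ⁅a, b⁆ * g = (b⁻¹ * a⁻¹)⁻¹ * ((a⁻¹ * b⁻¹) * g * (a⁻¹ * b⁻¹)⁻¹) * (a⁻¹ * b⁻¹) := by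
          rw [commutatorElement_def]; group
      _ = (b⁻¹ * a⁻¹)⁻¹ * ((b⁻¹ * a⁻¹) * g * (b⁻¹ * a⁻¹)⁻¹) * (a⁻¹ * b⁻¹) := by rw [h1, h2]
      _ = g * ⁅a, b⁆ := by rw [commutatorElement_def]; group
  obtain ⟨m, rfl⟩ := hgen' y hy
  have h := Subgroup.mem_centralizer_singleton_iff.1 (hle hx)
  exact (Commute.zpow_right h m)

end Supersolvable

/-! ### Building a supersolvable series one generator at a time. -/

section SupersolvablyEmbedded

variable {G : Type*} [Group G]

/-- The subgroups obtained from `⊥` by successively adjoining elements which, modulo the subgroup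
already obtained, generate a normal subgroup. -/
inductive SupersolvablyEmbedded : Subgroup G → Prop
  | bot : SupersolvablyEmbedded ⊥
  | adjoin {N : Subgroup G} {g : G} (hN : SupersolvablyEmbedded N)
      (hg : ∀ γ : G, γ * g * γ⁻¹ ∈ N ⊔ Subgroup.zpowers g) :
      SupersolvablyEmbedded (N ⊔ Subgroup.zpowers g)

theorem SupersolvablyEmbedded.normal {N : Subgroup G} (hN : SupersolvablyEmbedded N) :
    N.Normal := by
  induction hN with
  | bot => infer_instance
  | @adjoin N g hN hg ih =>
    refine ⟨fun x hx γ => ?_⟩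
    have hle : N ⊔ Subgroup.zpowers g ≤
        (N ⊔ Subgroup.zpowers g).comap (MulAut.conj γ).toMonoidHom := by
      refine sup_le (fun y hy => ?_) ?_
      · exact Subgroup.mem_sup_left (ih.conj_mem y hy γ)
      · rw [Subgroup.zpowers_le]
        exact hg γ
    exact hle hx

theorem SupersolvablyEmbedded.isSupersolvable (h : SupersolvablyEmbedded (⊤ : Subgroup G)) :
    IsSupersolvable G := by
  suffices H : ∀ M : Subgroup G, SupersolvablyEmbedded M →
      ∃ (n : ℕ) (N : ℕ → Subgroup G) (_ : ∀ i, (N i).Normal), N 0 = ⊥ ∧ N n = M ∧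
      ∀ i < n, N i ≤ N (i + 1) ∧ IsCyclic (N (i + 1) ⧸ (N i).subgroupOf (N (i + 1))) from H ⊤ h
  intro M hM
  induction hM with
  | bot => exact ⟨0, fun _ => ⊥, fun _ => inferInstance, rfl, rfl, fun i hi => by omega⟩
  | @adjoin N g hN hg ih =>
    obtain ⟨n, S, hS, h0, hn, hc⟩ := ih
    have hMn := (SupersolvablyEmbedded.adjoin hN hg).normal
    have hNn := hN.normal
    -- The series is indexed by all of `ℕ` with every term normal, so it stays constant beyond the
    -- new top.
    let T : ℕ → Subgroup G := fun i => if i ≤ n then S i else N ⊔ Subgroup.zpowers g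
    have hT : ∀ i, (T i).Normal := fun i => by
      by_cases hi : i ≤ n
      · simpa [T, hi] using hS i
      · simpa [T, hi] using hMn
    refine ⟨n + 1, T, hT, by simp [T, h0], by simp [T], fun i hi => ?_⟩
    rw [isCyclic_quotient_subgroupOf_iff]
    by_cases hin : i < n
    · have h1 : T i = S i := by simp [T, hin.le]
      have h2 : T (i + 1) = S (i + 1) := by simp [T, Nat.succ_le_of_lt hin]
      rw [h1, h2]
      exact ⟨(hc i hin).1, isCyclic_quotient_subgroupOf_iff.1 (hc i hin).2⟩
    · obtain rfl : i = n := by omega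
      have h1 : T i = N := by simp [T, hn]
      have h2 : T (i + 1) = N ⊔ Subgroup.zpowers g := by simp [T]
      rw [h1, h2]
      refine ⟨le_sup_left, g, Subgroup.mem_sup_right (Subgroup.mem_zpowers g), fun x hx => ?_⟩
      obtain ⟨b, ⟨m, rfl⟩, a, ha, rfl⟩ := Subgroup.mem_sup_of_normal_right.1
        (by rwa [sup_comm] at hx : x ∈ Subgroup.zpowers g ⊔ N)
      exact ⟨m, by simpa using ha⟩

/-- Elements that are each normalized modulo `N` remain so modulo anything larger, hence they can be
adjoined in any order. -/
theorem SupersolvablyEmbedded.sup_closure {N : Subgroup G} (hN : SupersolvablyEmbedded N)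
    {T : Set G} (hT : T.Finite) (h : ∀ g ∈ T, ∀ γ : G, γ * g * γ⁻¹ ∈ N ⊔ Subgroup.zpowers g) :
    SupersolvablyEmbedded (N ⊔ Subgroup.closure T) := by
  induction T, hT using Set.Finite.induction_on with
  | empty => simpa using hN
  | @insert g T _ _ ih =>
    have h1 := ih fun g' hg' => h g' (Set.mem_insert_of_mem _ hg')
    have h2 : N ⊔ Subgroup.closure (insert g T) =
        (N ⊔ Subgroup.closure T) ⊔ Subgroup.zpowers g := by
      rw [Set.insert_eq, Subgroup.closure_union, ← Subgroup.zpowers_eq_closure, sup_assoc,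
        sup_comm (Subgroup.zpowers g)]
    rw [h2]
    refine h1.adjoin fun γ => ?_
    exact (sup_le_sup_right le_sup_left _ :
      N ⊔ Subgroup.zpowers g ≤ N ⊔ Subgroup.closure T ⊔ Subgroup.zpowers g)
      (h g (Set.mem_insert _ _) γ)

end SupersolvablyEmbedded

/-! ### Radicals, roots of unity and Kummer theory. -/

section Radical

variable {k K L : Type*} [Field k] [Field K] [Field L] [Algebra k K] [Algebra K L] [Algebra k L]
  [IsScalarTower k K L]

theorem smul_mem_scalarUnits {x : Lˣ} (hx : x ∈ scalarUnits k L) (σ : L ≃ₐ[K] L) :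
    σ • x = x := by
  obtain ⟨c, rfl⟩ := hx
  ext
  change σ (algebraMap k L c) = algebraMap k L c
  rw [IsScalarTower.algebraMap_apply k K L, σ.commutes]

/-- The Galois conjugates of finitely many radicals differ from them by powers of one root of
unity. -/
theorem exists_root_of_unity_of_finite_radicals [FiniteDimensional K L] {S : Set Lˣ}
    (hS : S.Finite) (hrad : S ⊆ radGroup k L) :
    ∃ ζ ∈ radGroup k L, (∀ σ : L ≃ₐ[K] L, σ • ζ ∈ Subgroup.zpowers ζ) ∧
      ∀ s ∈ S, ∀ σ : L ≃ₐ[K] L, σ • s * s⁻¹ ∈ Subgroup.zpowers ζ := by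
  let R : Set Lˣ := (fun p : (L ≃ₐ[K] L) × Lˣ => p.1 • p.2 * p.2⁻¹) '' (Set.univ ×ˢ S)
  have hR : R.Finite := (Set.finite_univ.prod hS).image _
  -- If `s ^ n` lies in `k`, it is fixed by `σ`, so `σ(s)/s` is an `n`-th root of unity.
  have htor : ∀ x ∈ Subgroup.closure R, IsOfFinOrder x := by
    intro x hx
    suffices Subgroup.closure R ≤ CommGroup.torsion Lˣ from this hx
    rw [Subgroup.closure_le]
    rintro _ ⟨⟨σ, s⟩, ⟨-, hs⟩, rfl⟩
    obtain ⟨n, hn, h⟩ := hrad hs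
    refine isOfFinOrder_iff_pow_eq_one.2 ⟨n, hn, ?_⟩
    change (σ • s * s⁻¹) ^ n = 1
    rw [mul_pow, ← smul_pow', smul_mem_scalarUnits h, inv_pow, mul_inv_cancel]
  have hfin : Finite (Subgroup.closure R) := by
    have := hR.to_subtype
    have : Group.FG (Subgroup.closure R) := Group.closure_finite_fg R
    refine CommGroup.finite_of_fg_isMulTorsion _ fun x => ?_
    exact Submonoid.isOfFinOrder_coe.1 (htor x x.2)
  obtain ⟨⟨ζ, hζ⟩, hgen⟩ := IsCyclic.exists_generator (α := Subgroup.closure R)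
  have hz : Subgroup.closure R ≤ Subgroup.zpowers ζ := fun x hx => by
    obtain ⟨m, hm⟩ := hgen ⟨x, hx⟩
    exact ⟨m, congrArg Subtype.val hm⟩
  refine ⟨ζ, ?_, fun σ => hz ?_, fun s hs σ =>
    hz (Subgroup.subset_closure ⟨(σ, s), ⟨trivial, hs⟩, rfl⟩)⟩
  · obtain ⟨n, hn, h⟩ := isOfFinOrder_iff_pow_eq_one.1 (htor ζ hζ)
    exact ⟨n, hn, h ▸ one_mem _⟩
  · suffices Subgroup.closure R ≤
        (Subgroup.closure R).comap (MulDistribMulAction.toMonoidHom Lˣ σ) from this hζ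
    rw [Subgroup.closure_le]
    rintro _ ⟨⟨τ, s⟩, ⟨-, hs⟩, rfl⟩
    change σ • (τ • s * s⁻¹) ∈ Subgroup.closure R
    -- The cocycle identity for `σ ↦ σ(s)/s` makes the group of these roots of unity Galois-stable.
    have h1 : σ • (τ • s * s⁻¹) = ((σ * τ) • s * s⁻¹) * (σ • s * s⁻¹)⁻¹ := by
      rw [smul_mul', smul_inv', mul_smul]
      group
    rw [h1]
    exact mul_mem (Subgroup.subset_closure ⟨(σ * τ, s), ⟨trivial, hs⟩, rfl⟩)
      (inv_mem (Subgroup.subset_closure ⟨(σ, s), ⟨trivial, hs⟩, rfl⟩))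

theorem smul_eq_of_mem_zpowers {ζ z : Lˣ} {σ : L ≃ₐ[K] L} {j : ℤ} (h : σ • ζ = ζ ^ j)
    (hz : z ∈ Subgroup.zpowers ζ) : σ • z = z ^ j := by
  obtain ⟨m, rfl⟩ := hz
  change σ • ζ ^ m = (ζ ^ m) ^ j
  rw [smul_zpow', h, ← zpow_mul, ← zpow_mul, mul_comm]

/-- Kummer theory: `σ` multiplies each `s` by some `z ∈ ⟨ζ⟩` that it fixes, so `σ ^ j` multiplies
`s` by `z ^ j = τ(z)`, which is also what the conjugate of `σ` by `τ` does. Automorphisms over `k`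
are determined on a spanning set. -/
theorem conj_eq_zpow_of_fixes_root {S : Set Lˣ} {ζ : Lˣ}
    (hspan : Submodule.span k (Units.val '' S) = ⊤)
    (hS : ∀ s ∈ S, ∀ σ : L ≃ₐ[K] L, σ • s * s⁻¹ ∈ Subgroup.zpowers ζ)
    {σ τ : L ≃ₐ[K] L} (hσ : σ • ζ = ζ) {j : ℤ} (hτ : τ • ζ = ζ ^ j) :
    τ * σ * τ⁻¹ = σ ^ j := by
  have hσ1 : ∀ z ∈ Subgroup.zpowers ζ, σ • z = z := fun z hz => by
    simpa using smul_eq_of_mem_zpowers (j := 1) (by simpa using hσ) hz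
  have hpow : ∀ s ∈ S, ∀ m : ℤ, σ ^ m • s = (σ • s * s⁻¹) ^ m * s := by
    intro s hs m
    have hz := hσ1 _ (hS s hs σ)
    have hstep : ∀ m : ℤ, σ • ((σ • s * s⁻¹) ^ m * s) = (σ • s * s⁻¹) ^ (m + 1) * s := fun m => by
      rw [smul_mul', smul_zpow', hz, zpow_add_one]
      group
    induction m with
    | zero => simp
    | succ m ih => rw [add_comm, zpow_one_add, mul_smul, ih, hstep, add_comm]
    | pred m ih =>
      have h1 := hstep (-m - 1)
      rw [sub_add_cancel, ← ih, show (-(m : ℤ)) = 1 + (-m - 1) by ring, zpow_one_add, mul_smul]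
        at h1
      have h2 := smul_left_cancel σ h1
      rw [show (1 + (-(m : ℤ) - 1) - 1) = -m - 1 by ring] at h2
      exact h2.symm
  have key : ∀ s ∈ S, (τ * σ * τ⁻¹) • s = σ ^ j • s := by
    intro s hs
    rw [hpow s hs, ← smul_eq_of_mem_zpowers hτ (hS s hs σ), mul_smul, mul_smul]
    have hw := hσ1 _ (hS s hs τ⁻¹)
    have h1 : σ • τ⁻¹ • s = (σ • s * s⁻¹) * τ⁻¹ • s := by
      calc σ • τ⁻¹ • s = σ • ((τ⁻¹ • s * s⁻¹) * s) := by rw [inv_mul_cancel_right]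
        _ = (σ • s * s⁻¹) * τ⁻¹ • s := by
          rw [smul_mul', hw, mul_comm (σ • s) s⁻¹, mul_assoc, mul_comm (τ⁻¹ • s), mul_assoc]
    rw [h1, smul_mul', smul_inv_smul]
  have hlin : (τ * σ * τ⁻¹).toLinearMap.restrictScalars k =
      (σ ^ j).toLinearMap.restrictScalars k := by
    apply LinearMap.ext_on hspan
    rintro _ ⟨s, hs, rfl⟩
    exact congrArg Units.val (key s hs)
  ext x
  exact LinearMap.congr_fun hlin x

/-- Over an algebraic extension the field and the ring generated by the radicals agree, and the ring
is their linear span because radicals are closed under multiplication. Finite dimension then permits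
a finite choice. -/
theorem exists_finite_radicals_span [FiniteDimensional k L] (h : IsRadicalExtension k L) :
    ∃ S : Set Lˣ, S.Finite ∧ S ⊆ radGroup k L ∧
      Submodule.span k (Units.val '' S) = ⊤ := by
  let P : Submonoid L := (radGroup k L).toSubmonoid.map (Units.coeHom L)
  have h1 : Algebra.adjoin k (P : Set L) = ⊤ := by
    have : IntermediateField.adjoin k (P : Set L) = ⊤ := h
    rw [← IntermediateField.adjoin_toSubalgebra, this]
    rfl
  have h2 : Submodule.span k (P : Set L) = ⊤ := by
    rw [← Algebra.top_toSubmodule, ← h1, Algebra.adjoin_eq_span, Submonoid.closure_eq]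
  obtain ⟨s, hs, hs'⟩ := (Submodule.fg_span_iff_fg_span_finset_subset (P : Set L)).1
    (h2 ▸ Module.Finite.fg_top)
  refine ⟨Units.val ⁻¹' (s : Set L) ∩ radGroup k L, ?_, Set.inter_subset_right, ?_⟩
  · exact (s.finite_toSet.preimage (Units.val_injective.injOn)).subset Set.inter_subset_left
  · rw [← h2, hs']
    congr 1
    ext x
    constructor
    · rintro ⟨y, hy, rfl⟩
      exact hy.1
    · intro hx
      obtain ⟨y, hy, rfl⟩ := hs hx
      exact ⟨y, ⟨hx, hy⟩, rfl⟩

theorem finiteIndex_scalarUnits_subgroupOf_closure {S : Set Lˣ} (hS : S.Finite)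
    (hrad : S ⊆ radGroup k L) :
    ((scalarUnits k L).subgroupOf (Subgroup.closure S)).FiniteIndex := by
  have := hS.to_subtype
  have : Group.FG (Subgroup.closure S) := Group.closure_finite_fg S
  have : Finite (Subgroup.closure S ⧸ (scalarUnits k L).subgroupOf (Subgroup.closure S)) := by
    refine CommGroup.finite_of_fg_isMulTorsion _ fun q => ?_
    obtain ⟨⟨x, hx⟩, rfl⟩ := QuotientGroup.mk_surjective q
    obtain ⟨n, hn, h⟩ := (Subgroup.closure_le _).2 hrad hx
    refine isOfFinOrder_iff_pow_eq_one.2 ⟨n, hn, ?_⟩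
    rw [← QuotientGroup.mk_pow, QuotientGroup.eq_one_iff]
    exact h
  exact Subgroup.finiteIndex_of_finite_quotient

end Radical

/-! ### The group of monomial units in a crossed product. -/

section CrossedProductGroup

variable {K L A : Type*} [Field K] [Field L] [Algebra K L] [Ring A] [Algebra K A]
  {ι : L →ₐ[K] A} {u : (L ≃ₐ[K] L) → Aˣ} {t : (L ≃ₐ[K] L) × (L ≃ₐ[K] L) → Lˣ}

theorem unit_mul_map_eq (hu : ∀ σ x, (u σ : A) * ι x = ι (σ x) * (u σ : A)) (σ : L ≃ₐ[K] L)
    (x : Lˣ) : u σ * Units.map (ι : L →* A) x = Units.map (ι : L →* A) (σ • x) * u σ :=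
  Units.ext (hu σ x)

theorem unit_mul_unit_eq
    (ht : ∀ σ τ, (u σ : A) * (u τ : A) = ι (t (σ, τ) : L) * (u (σ * τ) : A))
    (σ τ : L ≃ₐ[K] L) : u σ * u τ = Units.map (ι : L →* A) (t (σ, τ)) * u (σ * τ) :=
  Units.ext (ht σ τ)

/-- The group `{m u_σ | m ∈ M}` of units of a crossed product, where `M` is a Galois-stable group
containing the values of the cocycle. -/
theorem exists_crossedProductGroup (hu : ∀ σ x, (u σ : A) * ι x = ι (σ x) * (u σ : A))
    (ht : ∀ σ τ, (u σ : A) * (u τ : A) = ι (t (σ, τ) : L) * (u (σ * τ) : A))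
    (M : Subgroup Lˣ) (hM : ∀ σ : L ≃ₐ[K] L, ∀ m ∈ M, σ • m ∈ M) (htM : ∀ p, t p ∈ M) :
    ∃ Γ : Subgroup Aˣ, ∀ x, x ∈ Γ ↔ ∃ m ∈ M, ∃ σ, x = Units.map (ι : L →* A) m * u σ := by
  have hu' := unit_mul_map_eq hu
  have ht' := unit_mul_unit_eq ht
  set j := Units.map (ι : L →* A)
  -- The cocycle is not assumed normalized: `u 1` need not be `1`, which explains the factors `t (1,
  -- 1)` below.
  have h1 : u 1 = j (t (1, 1)) := by simpa using ht' 1 1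
  refine ⟨{ carrier := {x | ∃ m ∈ M, ∃ σ, x = j m * u σ}
            one_mem' := ?_, mul_mem' := ?_, inv_mem' := ?_ }, fun x => Iff.rfl⟩
  · rintro _ _ ⟨m, hm, σ, rfl⟩ ⟨n, hn, τ, rfl⟩
    refine ⟨m * σ • n * t (σ, τ), mul_mem (mul_mem hm (hM σ n hn)) (htM _), σ * τ, ?_⟩
    calc j m * u σ * (j n * u τ) = j m * (u σ * j n) * u τ := by group
      _ = j m * j (σ • n) * (u σ * u τ) := by rw [hu']; group
      _ = _ := by rw [ht', map_mul, map_mul]; group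
  · exact ⟨(t (1, 1))⁻¹, inv_mem (htM _), 1, by rw [h1, map_inv, inv_mul_cancel]⟩
  · rintro _ ⟨m, hm, σ, rfl⟩
    refine ⟨(t (1, 1))⁻¹ * (t (σ⁻¹, σ))⁻¹ * σ⁻¹ • m⁻¹,
      mul_mem (mul_mem (inv_mem (htM _)) (inv_mem (htM _))) (hM _ _ (inv_mem hm)), σ⁻¹, ?_⟩
    rw [eq_comm, eq_inv_iff_mul_eq_one]
    have h2 := ht' σ⁻¹ σ
    rw [inv_mul_cancel, h1, ← map_mul] at h2
    calc j ((t (1, 1))⁻¹ * (t (σ⁻¹, σ))⁻¹ * σ⁻¹ • m⁻¹) * u σ⁻¹ * (j m * u σ)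
        = j ((t (1, 1))⁻¹ * (t (σ⁻¹, σ))⁻¹ * σ⁻¹ • m⁻¹) * (u σ⁻¹ * j m) * u σ := by group
      _ = j ((t (1, 1))⁻¹ * (t (σ⁻¹, σ))⁻¹ * σ⁻¹ • m⁻¹) * j (σ⁻¹ • m) * (u σ⁻¹ * u σ) := by
        rw [hu']; group
      _ = j ((t (1, 1))⁻¹ * (t (σ⁻¹, σ))⁻¹ * σ⁻¹ • m⁻¹ * σ⁻¹ • m * (t (σ⁻¹, σ) * t (1, 1))) := by
        rw [h2, ← map_mul, ← map_mul]
      _ = 1 := by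
        rw [smul_inv', inv_mul_cancel_right, mul_comm (t (σ⁻¹, σ)), ← mul_inv_rev,
          mul_comm (t (σ⁻¹, σ)), inv_mul_cancel, map_one]

/-- The unit `x` of `A` induces the automorphism `σ` of `L` by conjugation. -/
def Induces (ι : L →ₐ[K] A) (x : Aˣ) (σ : L ≃ₐ[K] L) : Prop :=
  ∀ l : L, (x : A) * ι l = ι (σ l) * x

theorem Induces.mul {x y : Aˣ} {σ τ : L ≃ₐ[K] L} (hx : Induces ι x σ) (hy : Induces ι y τ) :
    Induces ι (x * y) (σ * τ) := fun l => by
  rw [Units.val_mul, mul_assoc, hy, ← mul_assoc, hx, mul_assoc]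
  rfl

theorem Induces.inv {x : Aˣ} {σ : L ≃ₐ[K] L} (hx : Induces ι x σ) :
    Induces ι x⁻¹ σ⁻¹ := fun l => by
  have h := hx (σ⁻¹ l)
  rw [show σ (σ⁻¹ l) = l from σ.apply_symm_apply l] at h
  rw [Units.inv_mul_eq_iff_eq_mul, ← mul_assoc, h, mul_assoc, Units.mul_inv, mul_one]

theorem Induces.zpow {x : Aˣ} {σ : L ≃ₐ[K] L} (hx : Induces ι x σ) (n : ℤ) :
    Induces ι (x ^ n) (σ ^ n) := by
  have h1 : Induces ι (1 : Aˣ) (1 : L ≃ₐ[K] L) := fun l => by simp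
  have h : ∀ n : ℕ, Induces ι (x ^ n) (σ ^ n) := fun n => by
    induction n with
    | zero => simpa using h1
    | succ n ih => rw [pow_succ, pow_succ]; exact ih.mul hx
  cases n with
  | ofNat n => simpa using h n
  | negSucc n => simpa using (h (n + 1)).inv

theorem Induces.unique [Nontrivial A] {x : Aˣ} {σ τ : L ≃ₐ[K] L} (hx : Induces ι x σ)
    (hx' : Induces ι x τ) : σ = τ := by
  ext l
  exact ι.injective (x.isUnit.mul_right_cancel ((hx l).symm.trans (hx' l)))

theorem induces_map (m : Lˣ) : Induces ι (Units.map (ι : L →* A) m) 1 := fun l => by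
  change ι m * ι l = ι l * ι m
  rw [← map_mul, ← map_mul, mul_comm]

end CrossedProductGroup

theorem smul_mem_closure_of_conjugates_mem {K L : Type*} [Field K] [Field L] [Algebra K L]
    {S : Set Lˣ} {ζ : Lˣ} (hζ : ∀ σ : L ≃ₐ[K] L, σ • ζ ∈ Subgroup.zpowers ζ)
    (hζS : ∀ s ∈ S, ∀ σ : L ≃ₐ[K] L, σ • s * s⁻¹ ∈ Subgroup.zpowers ζ) (σ : L ≃ₐ[K] L)
    {m : Lˣ} (hm : m ∈ Subgroup.closure (insert ζ S)) :
    σ • m ∈ Subgroup.closure (insert ζ S) := by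
  have hle : Subgroup.zpowers ζ ≤ Subgroup.closure (insert ζ S) := by
    rw [Subgroup.zpowers_le]
    exact Subgroup.subset_closure (Set.mem_insert _ _)
  suffices Subgroup.closure (insert ζ S) ≤
      (Subgroup.closure (insert ζ S)).comap (MulDistribMulAction.toMonoidHom Lˣ σ) from this hm
  rw [Subgroup.closure_le]
  rintro s (rfl | hs)
  · exact hle (hζ σ)
  · change σ • s ∈ Subgroup.closure (insert ζ S)
    rw [← inv_mul_cancel_right (σ • s) s]
    exact mul_mem (hle (hζS s hs σ)) (Subgroup.subset_closure (Set.mem_insert_of_mem _ hs))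

/-! ### The monomial group is supersolvable and finite modulo scalars. -/

section GeneratedBySupersolvable

variable {k K L A : Type*} [Field k] [Field K] [Field L] [Algebra k K] [Algebra K L] [Algebra k L]
  [IsScalarTower k K L] [Ring A] [Algebra K A] [FiniteDimensional K L]
  {ι : L →ₐ[K] A} {u : (L ≃ₐ[K] L) → Aˣ}

theorem isSupersolvable_crossedProductGroup [Nontrivial A] (hu : ∀ σ, Induces ι (u σ) σ)
    {S : Set Lˣ} (hS : S.Finite) (hspan : Submodule.span k (Units.val '' S) = ⊤) {ζ : Lˣ}
    (hζ : ∀ σ : L ≃ₐ[K] L, σ • ζ ∈ Subgroup.zpowers ζ)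
    (hζS : ∀ s ∈ S, ∀ σ : L ≃ₐ[K] L, σ • s * s⁻¹ ∈ Subgroup.zpowers ζ)
    {Γ : Subgroup Aˣ} (hΓ : ∀ x, x ∈ Γ ↔ ∃ m ∈ Subgroup.closure (insert ζ S), ∃ σ,
      x = Units.map (ι : L →* A) m * u σ)
    (huΓ : ∀ σ, u σ ∈ Γ) (hMΓ : ∀ m ∈ Subgroup.closure (insert ζ S), Units.map (ι : L →* A) m ∈ Γ) :
    IsSupersolvable Γ := by
  set M := Subgroup.closure (insert ζ S) with hMdef
  have hζM : ζ ∈ M := Subgroup.subset_closure (Set.mem_insert _ _)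
  have hSM : ∀ s ∈ S, s ∈ M := fun s hs => Subgroup.subset_closure (Set.mem_insert_of_mem _ hs)
  let J : M →* Γ := ((Units.map (ι : L →* A)).comp M.subtype).codRestrict Γ fun m => hMΓ m m.2
  let U : (L ≃ₐ[K] L) → Γ := fun σ => ⟨u σ, huΓ σ⟩
  have hdec : ∀ γ : Γ, ∃ m : M, ∃ σ, γ = J m * U σ ∧ Induces ι (γ : Aˣ) σ := by
    rintro ⟨γ, hγ⟩
    obtain ⟨m, hm, σ, rfl⟩ := (hΓ γ).1 hγ
    refine ⟨⟨m, hm⟩, σ, rfl, ?_⟩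
    simpa using (induces_map m).mul (hu σ)
  have hdec' : ∀ (γ : Γ) (σ : L ≃ₐ[K] L), Induces ι (γ : Aˣ) σ → ∃ m : M, γ = J m * U σ := by
    intro γ σ h
    obtain ⟨m, σ', h1, h2⟩ := hdec γ
    exact ⟨m, h.unique h2 ▸ h1⟩
  have hker : ∀ γ : Γ, Induces ι (γ : Aˣ) (1 : L ≃ₐ[K] L) → ∃ m : M, γ = J m := by
    intro γ h
    obtain ⟨m, h1⟩ := hdec' γ 1 h
    -- Decomposing the identity of `Γ` shows that `U 1` comes from `M`, again without normalizing
    -- the cocycle.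
    obtain ⟨m', h2⟩ : ∃ m' : M, (1 : Γ) = J m' * U 1 := hdec' 1 1 (fun l => by simp)
    refine ⟨m * m'⁻¹, ?_⟩
    rw [map_mul, map_inv, h1, eq_inv_of_mul_eq_one_right h2.symm]
  have hJ : ∀ (γ : Γ) (σ : L ≃ₐ[K] L), Induces ι (γ : Aˣ) σ → ∀ m m' : M,
      σ • (m : Lˣ) = m' → γ * J m * γ⁻¹ = J m' := by
    intro γ σ h m m' hm
    rw [mul_inv_eq_iff_eq_mul]
    ext
    have := h (m : Lˣ)
    rw [show σ ((m : Lˣ) : L) = ((m' : Lˣ) : L) from congrArg Units.val hm] at this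
    exact this
  set N₁ := Subgroup.zpowers (J ⟨ζ, hζM⟩) with hN₁
  have hzN : ∀ m : M, (m : Lˣ) ∈ Subgroup.zpowers ζ → J m ∈ N₁ := by
    rintro ⟨_, hm⟩ ⟨n, rfl⟩
    refine ⟨n, ?_⟩
    change J ⟨ζ, hζM⟩ ^ n = _
    rw [← map_zpow]
    rfl
  have hSE₁ : SupersolvablyEmbedded N₁ := by
    have : N₁ = ⊥ ⊔ N₁ := by simp
    rw [this]
    refine SupersolvablyEmbedded.bot.adjoin fun γ => ?_
    obtain ⟨m, σ, -, hσ⟩ := hdec γ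
    have hmem : σ • ζ ∈ M := smul_mem_closure_of_conjugates_mem hζ hζS σ hζM
    rw [hJ γ σ hσ ⟨ζ, hζM⟩ ⟨σ • ζ, hmem⟩ rfl]
    exact Subgroup.mem_sup_right (hzN _ (hζ σ))
  -- Second layer: conjugation changes a radical from `S` by a power of `ζ`.
  let T₂ : Set Γ := {x | ∃ m : M, (m : Lˣ) ∈ S ∧ J m = x}
  have hT₂ : T₂.Finite := by
    have : (Subtype.val ⁻¹' S : Set M).Finite := hS.preimage Subtype.val_injective.injOn
    exact this.image J
  set N₂ := N₁ ⊔ Subgroup.closure T₂ with hN₂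
  have hSE₂ : SupersolvablyEmbedded N₂ := by
    refine hSE₁.sup_closure hT₂ ?_
    rintro _ ⟨m, hm, rfl⟩ γ
    obtain ⟨-, σ, -, hσ⟩ := hdec γ
    have hmem : σ • (m : Lˣ) ∈ M := smul_mem_closure_of_conjugates_mem hζ hζS σ m.2
    have hmem' : σ • (m : Lˣ) * (m : Lˣ)⁻¹ ∈ M := mul_mem hmem (inv_mem m.2)
    rw [hJ γ σ hσ m (⟨_, hmem'⟩ * m) (by simp), map_mul]
    exact mul_mem (Subgroup.mem_sup_left (hzN _ (hζS m hm σ)))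
      (Subgroup.mem_sup_right (Subgroup.mem_zpowers _))
  have hJN₂ : ∀ m : M, J m ∈ N₂ := by
    rintro ⟨m, hm⟩
    induction hm using Subgroup.closure_induction with
    | mem x hx =>
      rcases hx with rfl | hx
      · exact Subgroup.mem_sup_left (Subgroup.mem_zpowers _)
      · exact Subgroup.mem_sup_right (Subgroup.subset_closure ⟨⟨x, hSM x hx⟩, hx, rfl⟩)
    | one => exact (map_one J).symm ▸ one_mem _
    | mul x y hx hy ihx ihy =>
      have : J ⟨x * y, mul_mem hx hy⟩ = J ⟨x, hx⟩ * J ⟨y, hy⟩ := by rw [← map_mul]; rfl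
      exact this ▸ mul_mem ihx ihy
    | inv x hx ihx =>
      have : J ⟨x⁻¹, inv_mem hx⟩ = (J ⟨x, hx⟩)⁻¹ := by rw [← map_inv]; rfl
      exact this ▸ inv_mem ihx
  -- Third layer: the `u_σ` with `σ` fixing `ζ`; modulo `M`, conjugation sends such a unit to a
  -- power of itself.
  set N₃ := N₂ ⊔ Subgroup.closure (U '' {σ | σ • ζ = ζ}) with hN₃
  have hSE₃ : SupersolvablyEmbedded N₃ := by
    refine hSE₂.sup_closure (Set.toFinite _) ?_
    rintro _ ⟨σ, hσ, rfl⟩ γ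
    obtain ⟨-, τ, -, hτ⟩ := hdec γ
    obtain ⟨j, hj⟩ := hζ τ
    have hconj := conj_eq_zpow_of_fixes_root hspan hζS hσ hj.symm
    have hind : Induces ι ((γ * U σ * γ⁻¹ * (U σ ^ j)⁻¹ : Γ) : Aˣ) (1 : L ≃ₐ[K] L) := by
      have := ((hτ.mul (hu σ)).mul hτ.inv).mul ((hu σ).zpow j).inv
      rw [hconj, mul_inv_cancel] at this
      exact this
    obtain ⟨m, hm⟩ := hker _ hind
    rw [eq_mul_of_mul_inv_eq hm]
    exact mul_mem (Subgroup.mem_sup_left (hJN₂ m))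
      (Subgroup.mem_sup_right (zpow_mem (Subgroup.mem_zpowers _) j))
  -- Last layer: the Galois group acts on `⟨ζ⟩` through an abelian quotient, so commutators fix `ζ`
  -- and fall into the third layer.
  have hSE₄ : SupersolvablyEmbedded (N₃ ⊔ Subgroup.closure (Set.range U)) := by
    refine hSE₃.sup_closure (Set.toFinite _) ?_
    rintro _ ⟨σ, rfl⟩ γ
    obtain ⟨-, τ, -, hτ⟩ := hdec γ
    have hind : Induces ι ((γ * U σ * γ⁻¹ * (U σ)⁻¹ : Γ) : Aˣ) (τ * σ * τ⁻¹ * σ⁻¹) :=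
      ((hτ.mul (hu σ)).mul hτ.inv).mul (hu σ).inv
    obtain ⟨m, hm⟩ := hdec' _ _ hind
    have hfix : (τ * σ * τ⁻¹ * σ⁻¹) • ζ = ζ := by
      have hab : ∀ α β : L ≃ₐ[K] L, (α * β) • ζ = (β * α) • ζ := fun α β => by
        obtain ⟨a, ha⟩ := hζ α
        obtain ⟨b, hb⟩ := hζ β
        rw [mul_smul, mul_smul, smul_eq_of_mem_zpowers ha.symm (hζ β),
          smul_eq_of_mem_zpowers hb.symm (hζ α), ← ha, ← hb]
        change (ζ ^ b) ^ a = (ζ ^ a) ^ b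
        rw [← zpow_mul, ← zpow_mul, mul_comm]
      rw [mul_assoc (τ * σ), mul_smul, hab τ⁻¹, ← mul_smul, show τ * σ * (σ⁻¹ * τ⁻¹) = 1 by group,
        one_smul]
    rw [eq_mul_of_mul_inv_eq hm]
    exact mul_mem (Subgroup.mem_sup_left (mul_mem (Subgroup.mem_sup_left (hJN₂ m))
      (Subgroup.mem_sup_right (Subgroup.subset_closure ⟨_, hfix, rfl⟩))))
      (Subgroup.mem_sup_right (Subgroup.mem_zpowers _))
  have htop : N₃ ⊔ Subgroup.closure (Set.range U) = ⊤ := by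
    rw [eq_top_iff]
    intro γ _
    obtain ⟨m, σ, rfl, -⟩ := hdec γ
    exact mul_mem (Subgroup.mem_sup_left (Subgroup.mem_sup_left (hJN₂ m)))
      (Subgroup.mem_sup_right (Subgroup.subset_closure ⟨σ, rfl⟩))
  exact (htop ▸ hSE₄).isSupersolvable

/-- The finitely many products of a coset representative of `M` modulo `k^×` with some `u_σ` already
meet every coset. -/
theorem finiteIndex_crossedProductGroup [Algebra k A] [IsScalarTower k K A] (M : Subgroup Lˣ)
    [((scalarUnits k L).subgroupOf M).FiniteIndex]
    {Γ : Subgroup Aˣ} (hΓ : ∀ x, x ∈ Γ ↔ ∃ m ∈ M, ∃ σ, x = Units.map (ι : L →* A) m * u σ)  :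
    ((scalarUnits k A).subgroupOf Γ).FiniteIndex := by
  let f : (M ⧸ (scalarUnits k L).subgroupOf M) × (L ≃ₐ[K] L) →
      Γ ⧸ (scalarUnits k A).subgroupOf Γ := fun p =>
    QuotientGroup.mk ⟨Units.map (ι : L →* A) p.1.out * u p.2, (hΓ _).2 ⟨_, p.1.out.2, _, rfl⟩⟩
  have hf : Function.Surjective f := by
    intro q
    obtain ⟨⟨x, hx⟩, rfl⟩ := QuotientGroup.mk_surjective q
    obtain ⟨m, hm, σ, rfl⟩ := (hΓ x).1 hx
    refine ⟨(QuotientGroup.mk ⟨m, hm⟩, σ), ?_⟩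
    obtain ⟨⟨c, hc⟩, h1⟩ := QuotientGroup.mk_out_eq_mul ((scalarUnits k L).subgroupOf M) ⟨m, hm⟩
    simp only [f, h1]
    rw [QuotientGroup.eq]
    obtain ⟨a, ha⟩ := hc
    refine Subgroup.mem_subgroupOf.2 ⟨a⁻¹, ?_⟩
    have hcentral : ∀ y : Aˣ, y * Units.map (algebraMap k A : k →* A) a =
        Units.map (algebraMap k A : k →* A) a * y := fun y =>
      Units.ext (Algebra.commutes (a : k) (y : A)).symm
    have hca : Units.map (ι : L →* A) c = Units.map (algebraMap k A : k →* A) a := by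
      rw [show (c : Lˣ) = Units.map (algebraMap k L : k →* L) a from ha.symm]
      ext
      change ι (algebraMap k L a) = algebraMap k A a
      rw [IsScalarTower.algebraMap_apply k K L, ι.commutes, ← IsScalarTower.algebraMap_apply]
    change _ = (Units.map (ι : L →* A) (m * c) * u σ)⁻¹ * (Units.map (ι : L →* A) m * u σ)
    rw [map_mul, hca, map_inv, eq_inv_mul_iff_mul_eq, mul_inv_eq_iff_eq_mul, mul_assoc, mul_assoc,
      hcentral]
  have := Finite.of_surjective f hf
  exact Subgroup.finiteIndex_of_finite_quotient

end GeneratedBySupersolvable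

theorem IsRadicalOver.isGeneratedBySupersolvable {k : Type u} {K : Type v} {A : Type w} [Field k]
    [Field K] [Algebra k K] [Ring A] [Nontrivial A] [Algebra K A] [Algebra k A]
    [IsScalarTower k K A] [FiniteDimensional k K] (h : IsRadicalOver k K A) :
    IsGeneratedBySupersolvable k A := by
  obtain ⟨L, _, _, _, _, _, t, hL, htrad, -, -, ι, u, hbij, hu, hut⟩ := h
  have : FiniteDimensional k L := FiniteDimensional.trans k K L
  -- Enlarging the spanning set by the finitely many values of `t` makes the monomial units closed
  -- under multiplication.
  obtain ⟨S₀, hS₀, hS₀rad, hS₀span⟩ := exists_finite_radicals_span hL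
  set S := S₀ ∪ Set.range t with hSdef
  have hS : S.Finite := hS₀.union (Set.finite_range t)
  have hSrad : S ⊆ radGroup k L := by
    rintro x (hx | ⟨p, rfl⟩)
    exacts [hS₀rad hx, htrad p]
  have hspan : Submodule.span k (Units.val '' S) = ⊤ := by
    rw [eq_top_iff, ← hS₀span]
    exact Submodule.span_mono (Set.image_mono Set.subset_union_left)
  obtain ⟨ζ, hζrad, hζ, hζS⟩ := exists_root_of_unity_of_finite_radicals (K := K) hS hSrad
  have htM : ∀ p, t p ∈ Subgroup.closure (insert ζ S) := fun p =>
    Subgroup.subset_closure (Set.mem_insert_of_mem _ (Or.inr ⟨p, rfl⟩))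
  obtain ⟨Γ, hΓ⟩ := exists_crossedProductGroup hu hut (Subgroup.closure (insert ζ S))
    (fun σ m hm => smul_mem_closure_of_conjugates_mem hζ hζS σ hm) htM
  have huΓ : ∀ σ, u σ ∈ Γ := fun σ => (hΓ _).2 ⟨1, one_mem _, σ, by simp⟩
  have h1 : u 1 = Units.map (ι : L →* A) (t (1, 1)) := by
    simpa using unit_mul_unit_eq hut 1 1
  have hMΓ : ∀ m ∈ Subgroup.closure (insert ζ S), Units.map (ι : L →* A) m ∈ Γ := fun m hm =>
    (hΓ _).2 ⟨m * (t (1, 1))⁻¹, mul_mem hm (inv_mem (htM _)), 1, by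
      rw [map_mul, map_inv, h1, inv_mul_cancel_right]⟩
  have hfi := finiteIndex_scalarUnits_subgroupOf_closure (hS.insert ζ)
    (Set.insert_subset hζrad hSrad)
  refine ⟨Γ, isSupersolvable_crossedProductGroup hu hS hspan hζ hζS hΓ huΓ hMΓ,
    finiteIndex_crossedProductGroup _ hΓ, ?_⟩
  rw [eq_top_iff]
  rintro a -
  obtain ⟨c, rfl⟩ := hbij.2 a
  refine sum_mem fun σ _ => mul_mem ?_ (Algebra.subset_adjoin ⟨_, huΓ σ, rfl⟩)
  have hle : Submodule.span k (Units.val '' S) ≤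
      (Subalgebra.toSubmodule (Algebra.adjoin k (Units.val '' (Γ : Set Aˣ)))).comap
        (ι.toLinearMap.restrictScalars k) := by
    rw [Submodule.span_le]
    rintro _ ⟨s, hs, rfl⟩
    exact Algebra.subset_adjoin
      ⟨_, hMΓ s (Subgroup.subset_closure (Set.mem_insert_of_mem _ hs)), rfl⟩
  exact hle (hspan ▸ Submodule.mem_top)

/-! ### Corners `eAe` as algebras, and matrix units from conjugate idempotents. -/

section Corner

variable {R K A : Type*} [CommRing R] [CommRing K] [Ring A] [Algebra R A] [Algebra K A] {e : A}

namespace IsIdempotentElem.Corner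

variable (he : IsIdempotentElem e)

theorem mul_algebraMap_mul (he : IsIdempotentElem e) (r : R) :
    e * algebraMap R A r * e = algebraMap R A r * e := by
  rw [← Algebra.commutes, mul_assoc, he.eq]

/-- The element `e * a * e` of the corner. -/
def compress (a : A) : he.Corner := ⟨e * a * e, a, rfl⟩

/-- The base ring is kept general since the corner must be an algebra over both `k` and `K`. -/
instance : Algebra R he.Corner :=
  RingHom.toAlgebra'
    { toFun := fun r => compress he (algebraMap R A r)
      map_one' := Subtype.ext (by
        change e * algebraMap R A 1 * e = e
        rw [map_one, mul_one, he.eq])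
      map_mul' := fun r s => Subtype.ext (by
        change e * algebraMap R A (r * s) * e =
          e * algebraMap R A r * e * (e * algebraMap R A s * e)
        rw [mul_algebraMap_mul he, mul_algebraMap_mul he, mul_algebraMap_mul he, mul_assoc,
          ← mul_assoc e, mul_algebraMap_mul he, map_mul, mul_assoc])
      map_zero' := Subtype.ext (by
        change e * algebraMap R A 0 * e = 0
        simp)
      map_add' := fun r s => Subtype.ext (by
        change e * algebraMap R A (r + s) * e = e * algebraMap R A r * e + e * algebraMap R A s * e
        rw [map_add, mul_add, add_mul]) }
    fun r x => Subtype.ext (by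
      obtain ⟨h1, h2⟩ := (Subsemigroup.mem_corner_iff he).1 x.2
      change e * algebraMap R A r * e * x.1 = x.1 * (e * algebraMap R A r * e)
      rw [mul_algebraMap_mul he, mul_assoc, h1, ← mul_assoc, ← Algebra.commutes, mul_assoc, h2])

variable {he}

theorem mul_val (x : he.Corner) : e * x.1 = x.1 := ((Subsemigroup.mem_corner_iff he).1 x.2).1

theorem val_mul (x : he.Corner) : x.1 * e = x.1 := ((Subsemigroup.mem_corner_iff he).1 x.2).2

theorem val_algebraMap (r : R) : (algebraMap R he.Corner r).1 = algebraMap R A r * e := by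
  exact mul_algebraMap_mul he r

theorem val_smul (r : R) (x : he.Corner) : (r • x).1 = r • x.1 := by
  rw [Algebra.smul_def, Algebra.smul_def]
  change (algebraMap R he.Corner r).1 * x.1 = _
  rw [val_algebraMap, mul_assoc, mul_val]

theorem val_sum {ι : Type*} (s : Finset ι) (f : ι → he.Corner) :
    (∑ i ∈ s, f i).1 = ∑ i ∈ s, (f i).1 :=
  map_sum (⟨⟨Subtype.val, rfl⟩, fun _ _ => rfl⟩ : he.Corner →+ A) f s

variable (R he) in
/-- Compression `a ↦ e * a * e` as a linear map. -/
def compressₗ : A →ₗ[R] he.Corner where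
  toFun := compress he
  map_add' a b := Subtype.ext (by
    change e * (a + b) * e = e * a * e + e * b * e
    rw [mul_add, add_mul])
  map_smul' r a := Subtype.ext (by
    rw [val_smul]
    change e * (r • a) * e = r • (e * a * e)
    rw [mul_smul_comm, smul_mul_assoc])

theorem compress_val (x : he.Corner) : compress he x.1 = x :=
  Subtype.ext (by change e * x.1 * e = x.1; rw [mul_val, val_mul])

theorem compressₗ_surjective : Function.Surjective (compressₗ R he) :=
  fun x => ⟨x.1, compress_val x⟩

instance {k : Type*} [CommRing k] [Algebra k K] [Algebra k A] [IsScalarTower k K A] :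
    IsScalarTower k K he.Corner :=
  IsScalarTower.of_algebraMap_eq fun r => Subtype.ext (by
    rw [val_algebraMap, val_algebraMap, ← IsScalarTower.algebraMap_apply])

instance [Module.Finite R A] : Module.Finite R he.Corner :=
  Module.Finite.of_surjective (compressₗ R he) compressₗ_surjective

end IsIdempotentElem.Corner

open IsIdempotentElem.Corner

/-- If `1` is a sum of orthogonal conjugates of an idempotent `e`, then `A` is a matrix algebra
over `e * A * e`. -/
theorem nonempty_algEquiv_matrix_corner (he : IsIdempotentElem e) {I : Type*} [Fintype I]
    [DecidableEq I] (g : I → Aˣ)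
    (hortho : ∀ i j, i ≠ j → e * ((↑(g i)⁻¹ : A) * g j) * e = 0)
    (hsum : ∑ i, (g i : A) * e * (↑(g i)⁻¹ : A) = 1) :
    Nonempty (A ≃ₐ[K] Matrix I I he.Corner) := by
  have hdelta : ∀ i j, e * ((↑(g i)⁻¹ : A) * g j) * e = if i = j then e else 0 := by
    intro i j
    split_ifs with h
    · subst h
      rw [Units.inv_mul, mul_one, he.eq]
    · exact hortho i j h
  let f : A →ₗ[K] Matrix I I he.Corner :=
    { toFun := fun a => Matrix.of fun i j => compressₗ K he ((↑(g i)⁻¹ : A) * a * g j)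
      map_add' := fun a b => by
        ext i j
        simp [mul_add, add_mul]
      map_smul' := fun r a => by
        ext i j
        simp }
  have hf : ∀ a i j, (f a i j).1 = e * ((↑(g i)⁻¹ : A) * a * g j) * e := fun _ _ _ => rfl
  have hf1 : f 1 = 1 := by
    ext i j
    refine Subtype.ext ?_
    rw [hf, mul_one, hdelta, Matrix.one_apply]
    split_ifs <;> rfl
  have hfm : ∀ a b, f (a * b) = f a * f b := by
    intro a b
    ext i j
    refine Subtype.ext ?_
    rw [Matrix.mul_apply, val_sum]
    -- The conjugate idempotent is isolated in the middle, so that summing over `l` replaces it by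
    -- `1`.
    have h1 : ∀ l, (f a i l * f b l j).1 =
        e * (↑(g i)⁻¹ : A) * a * (g l * e * (↑(g l)⁻¹ : A)) * (b * g j * e) := by
      intro l
      change (f a i l).1 * (f b l j).1 = _
      rw [hf, hf]
      calc e * ((↑(g i)⁻¹ : A) * a * g l) * e * (e * ((↑(g l)⁻¹ : A) * b * g j) * e)
          = e * (↑(g i)⁻¹ : A) * a * (g l * (e * e) * (↑(g l)⁻¹ : A)) * (b * g j * e) := by
            simp only [mul_assoc]
        _ = _ := by rw [he.eq]
    simp_rw [h1, ← Finset.sum_mul, ← Finset.mul_sum, hsum, hf]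
    simp only [mul_assoc, one_mul]
  refine ⟨AlgEquiv.ofBijective (AlgHom.ofLinearMap f hf1 hfm) ⟨?_, ?_⟩⟩
  · refine (injective_iff_map_eq_zero _).2 fun a ha => ?_
    have ha' : ∀ i j, e * ((↑(g i)⁻¹ : A) * a * g j) * e = 0 := fun i j => by
      rw [← hf]
      exact congrArg (fun M : Matrix I I he.Corner => (M i j).1) ha
    calc a = (∑ i, (g i : A) * e * (↑(g i)⁻¹ : A)) * a * ∑ j, (g j : A) * e * (↑(g j)⁻¹ : A) := by
          rw [hsum, one_mul, mul_one]
      _ = ∑ i, ∑ j, g i * (e * ((↑(g i)⁻¹ : A) * a * g j) * e) * (↑(g j)⁻¹ : A) := by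
        rw [Finset.sum_mul, Finset.sum_mul_sum]
        simp only [mul_assoc]
      _ = 0 := by simp [ha']
  · intro M
    refine ⟨∑ i, ∑ j, g i * (M i j).1 * (↑(g j)⁻¹ : A), ?_⟩
    ext i j
    refine Subtype.ext ?_
    change (f _ i j).1 = _
    rw [hf]
    calc e * ((↑(g i)⁻¹ : A) * (∑ p, ∑ q, g p * (M p q).1 * (↑(g q)⁻¹ : A)) * g j) * e
        = ∑ p, ∑ q, (e * ((↑(g i)⁻¹ : A) * g p) * e) * (M p q).1 *
            (e * ((↑(g q)⁻¹ : A) * g j) * e) := by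
          simp only [Finset.mul_sum, Finset.sum_mul]
          refine Finset.sum_congr rfl fun p _ => Finset.sum_congr rfl fun q _ => ?_
          conv_lhs => rw [← val_mul (M p q), ← mul_val (M p q)]
          simp only [mul_assoc]
      _ = (M i j).1 := by
          simp only [hdelta, ite_mul, zero_mul, mul_ite, mul_zero, Finset.sum_ite_eq,
            Finset.sum_ite_eq', Finset.mem_univ, if_true, mul_val, val_mul]

end Corner

/-! ### Simplicity and centrality descend from a matrix algebra to its coefficients. -/

section MatrixDescent

variable {K C : Type*} [Field K] [Ring C] [Algebra K C] {I : Type*} [Fintype I] [Nonempty I]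

theorem isSimpleRing_of_matrix [h : IsSimpleRing (Matrix I I C)] : IsSimpleRing C where
  simple := letI := Classical.decEq I; TwoSidedIdeal.orderIsoMatrix (n := I) |>.isSimpleOrder

theorem isCentral_of_matrix [DecidableEq I] (h : Algebra.IsCentral K (Matrix I I C)) :
    Algebra.IsCentral K C where
  out := by
    intro z hz
    rw [Subalgebra.mem_center_iff] at hz
    have hmem : Matrix.scalar I z ∈ Subalgebra.center K (Matrix I I C) := by
      rw [Subalgebra.mem_center_iff]
      intro M
      exact ((Matrix.scalar_commute z (fun r => (hz r).symm) M)).symm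
    obtain ⟨c, hc⟩ := Algebra.mem_bot.1 (h.out hmem)
    obtain ⟨i⟩ := ‹Nonempty I›
    refine Algebra.mem_bot.2 ⟨c, ?_⟩
    have := congrFun (congrFun hc i) i
    simpa [Matrix.algebraMap_matrix_apply] using this

end MatrixDescent

/-- A group is closed under multiplication, so the algebra it generates is its linear span. -/
theorem span_units_eq_top {k A : Type*} [Field k] [Ring A] [Algebra k A] {Γ : Subgroup Aˣ}
    (h : Algebra.adjoin k (Units.val '' (Γ : Set Aˣ)) = ⊤) :
    Submodule.span k (Units.val '' (Γ : Set Aˣ)) = ⊤ := by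
  let P : Submonoid A := Γ.toSubmonoid.map (Units.coeHom A)
  have h1 : Algebra.adjoin k (P : Set A) = ⊤ := h
  change Submodule.span k (P : Set A) = ⊤
  rw [← Algebra.top_toSubmodule, ← h1, Algebra.adjoin_eq_span, Submonoid.closure_eq]

theorem finiteIndex_of_finiteIndex_comap {G G' : Type*} [Group G] [Group G'] {f : G →* G'}
    (hf : Function.Surjective f) {H : Subgroup G'} (h : (H.comap f).FiniteIndex) :
    H.FiniteIndex :=
  ⟨by rw [← Subgroup.index_comap_of_surjective H hf]; exact h.index_ne_zero⟩

/-! ### A supersolvable generating group for the corner. -/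

section CornerGroup

open IsIdempotentElem.Corner

variable {k A : Type*} [Field k] [Ring A] [Algebra k A] {e : A}

/-- The homomorphism `γ ↦ e * γ * e` from units commuting with `e` to units of the corner. -/
def cornerUnits (he : IsIdempotentElem e) (H : Subgroup Aˣ) (hH : ∀ γ ∈ H, (γ : A) * e = e * γ) :
    H →* he.Cornerˣ :=
  have key : ∀ x y : A, y * e = e * y → e * x * e * (e * y * e) = e * (x * y) * e := by
    intro x y h
    calc e * x * e * (e * y * e) = e * x * (e * e) * (y * e) := by simp only [mul_assoc]
      _ = e * x * (e * e * y) := by rw [h, he.eq, mul_assoc _ e, ← mul_assoc e, he.eq]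
      _ = e * (x * y) * e := by rw [he.eq, ← h]; simp only [mul_assoc]
  MonoidHom.toHomUnits
    { toFun := fun γ => compress he (γ : Aˣ)
      map_one' := Subtype.ext (by
        change e * 1 * e = e
        rw [mul_one, he.eq])
      map_mul' := fun γ γ' => Subtype.ext (key _ _ (hH _ γ'.2)).symm }

/-- Compression by `e` kills the elements of `Γ` that do not commute with `e` and is multiplicative
on those that do. The image of their subgroup therefore spans the corner, and it inherits
supersolvability and finiteness modulo `k^×`. -/
theorem isGeneratedBySupersolvable_corner (he : IsIdempotentElem e) {Γ : Subgroup Aˣ}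
    (hss : IsSupersolvable Γ) (hfi : ((scalarUnits k A).subgroupOf Γ).FiniteIndex)
    (hgen : Algebra.adjoin k (Units.val '' (Γ : Set Aˣ)) = ⊤)
    (h : ∀ γ ∈ Γ, (γ : A) * e = e * γ ∨ e * γ * e = 0) :
    IsGeneratedBySupersolvable k he.Corner := by
  let H : Subgroup Aˣ := Γ ⊓ (Submonoid.centralizer {e}).units
  have hH : ∀ γ ∈ H, (γ : A) * e = e * γ := fun γ hγ =>
    (Submonoid.mem_centralizer_iff.1 hγ.2.1 e rfl).symm
  have hH' : ∀ γ ∈ Γ, (γ : A) * e = e * γ → γ ∈ H := fun γ hγ h => by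
    refine ⟨hγ, (Submonoid.mem_units_iff _ _).2 ⟨?_, ?_⟩⟩
    · exact Submonoid.mem_centralizer_iff.2 fun x hx => by rw [Set.mem_singleton_iff.1 hx, h]
    · refine Submonoid.mem_centralizer_iff.2 fun x hx => ?_
      rw [Set.mem_singleton_iff.1 hx, Units.eq_inv_mul_iff_mul_eq, ← mul_assoc, h, mul_assoc,
        Units.mul_inv, mul_one]
  let φ := cornerUnits he H hH
  have hHss : IsSupersolvable H := by
    refine (hss.subgroup (H.subgroupOf Γ)).of_surjective
      (Subgroup.subgroupOfEquivOfLe (inf_le_left : H ≤ Γ)).toMonoidHom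
      (Subgroup.subgroupOfEquivOfLe (inf_le_left : H ≤ Γ)).surjective
  refine ⟨φ.range, hHss.of_surjective φ.rangeRestrict φ.rangeRestrict_surjective, ?_, ?_⟩
  · refine finiteIndex_of_finiteIndex_comap φ.rangeRestrict_surjective ?_
    have h1 : ((scalarUnits k A).subgroupOf H).FiniteIndex := by
      refine ⟨?_⟩
      change (scalarUnits k A).relIndex H ≠ 0
      exact fun h0 => hfi.index_ne_zero
        (Subgroup.relIndex_eq_zero_of_le_right (inf_le_left : H ≤ Γ) h0)
    refine Subgroup.finiteIndex_of_le (H := (scalarUnits k A).subgroupOf H) ?_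
    rintro γ ⟨c, hc⟩
    refine ⟨c, Units.ext (Subtype.ext ?_)⟩
    change (algebraMap k he.Corner c).1 = e * ((γ : Aˣ) : A) * e
    have hc' : algebraMap k A c = ((γ : Aˣ) : A) := congrArg Units.val hc
    rw [val_algebraMap, hc', ← hH γ γ.2, mul_assoc, he.eq]
  · have hspan := span_units_eq_top hgen
    have hle : Submodule.span k (Units.val '' (Γ : Set Aˣ)) ≤
        (Subalgebra.toSubmodule (Algebra.adjoin k (Units.val '' (φ.range : Set he.Cornerˣ)))).comap
          (compressₗ k he) := by
      rw [Submodule.span_le]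
      rintro _ ⟨γ, hγ, rfl⟩
      rcases h γ hγ with h1 | h1
      · exact Algebra.subset_adjoin ⟨φ ⟨γ, hH' γ hγ h1⟩, ⟨_, rfl⟩, rfl⟩
      · have : compressₗ k he (γ : A) = 0 := Subtype.ext h1
        rw [SetLike.mem_coe, Submodule.mem_comap, this]
        exact zero_mem _
    rw [eq_top_iff]
    rintro x -
    obtain ⟨a, rfl⟩ := compressₗ_surjective (R := k) x
    exact hle (hspan ▸ Submodule.mem_top)

end CornerGroup

/-! ### Normalized commutative subalgebras, nilpotents and idempotents. -/

section NormalCommutativeSubalgebra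

variable {K A : Type*} [Field K] [Ring A] [Algebra K A]

theorem conj_mem_adjoin {Γ N : Subgroup Aˣ} (hN : ∀ γ ∈ Γ, ∀ x ∈ N, γ * x * γ⁻¹ ∈ N) {γ : Aˣ}
    (hγ : γ ∈ Γ) {b : A} (hb : b ∈ Algebra.adjoin K (Units.val '' (N : Set Aˣ))) :
    γ * b * (↑γ⁻¹ : A) ∈ Algebra.adjoin K (Units.val '' (N : Set Aˣ)) := by
  induction hb using Algebra.adjoin_induction with
  | mem x hx =>
    obtain ⟨x, hx, rfl⟩ := hx
    exact Algebra.subset_adjoin ⟨_, hN γ hγ x hx, rfl⟩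
  | algebraMap r =>
    rw [← Algebra.commutes, mul_assoc, Units.mul_inv, mul_one]
    exact Subalgebra.algebraMap_mem _ r
  | add x y _ _ ihx ihy =>
    rw [mul_add, add_mul]
    exact add_mem ihx ihy
  | mul x y _ _ ihx ihy =>
    have : γ * (x * y) * (↑γ⁻¹ : A) = (γ * x * (↑γ⁻¹ : A)) * (γ * y * (↑γ⁻¹ : A)) := by
      simp only [mul_assoc, Units.inv_mul_cancel_left]
    rw [this]
    exact mul_mem ihx ihy

theorem adjoin_units_comm {N : Subgroup Aˣ} (hN : ∀ x ∈ N, ∀ y ∈ N, x * y = y * x) {a b : A}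
    (ha : a ∈ Algebra.adjoin K (Units.val '' (N : Set Aˣ)))
    (hb : b ∈ Algebra.adjoin K (Units.val '' (N : Set Aˣ))) : a * b = b * a := by
  have := Algebra.isMulCommutative_adjoin K (s := Units.val '' (N : Set Aˣ)) (by
    rintro _ ⟨x, hx, rfl⟩ _ ⟨y, hy, rfl⟩
    exact congrArg Units.val (hN x hx y hy))
  exact congrArg Subtype.val (this.is_comm.comm ⟨a, ha⟩ ⟨b, hb⟩)

theorem isNilpotent_conj {x : A} (hx : IsNilpotent x) (γ : Aˣ) :
    IsNilpotent (γ * x * (↑γ⁻¹ : A)) := by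
  obtain ⟨n, hn⟩ := hx
  exact ⟨n, by rw [Units.conj_pow, hn, mul_zero, zero_mul]⟩

/-- A commutative subalgebra of a simple algebra that is normalized by a spanning set of units is
reduced. -/
theorem eq_zero_of_isNilpotent_of_normalized [FiniteDimensional K A] [IsSimpleRing A]
    {k : Type*} [Field k] [Algebra k A] {Γ : Subgroup Aˣ}
    (hspan : Submodule.span k (Units.val '' (Γ : Set Aˣ)) = ⊤) {B : Subalgebra K A}
    (hcomm : ∀ a ∈ B, ∀ b ∈ B, a * b = b * a)
    (hconj : ∀ γ ∈ Γ, ∀ b ∈ B, (γ : A) * b * (↑γ⁻¹ : A) ∈ B) {x : A} (hx : x ∈ B)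
    (hnil : IsNilpotent x) : x = 0 := by
  -- For `γ ∈ Γ`, `a γ y = a (γ y γ⁻¹) γ` and the conjugate is again nilpotent in `B`. Hence the
  -- left annihilator of the nilpotents of `B` is a two-sided ideal.
  have hright : ∀ a : A, (∀ y ∈ B, IsNilpotent y → a * y = 0) → ∀ c : A, ∀ y ∈ B,
      IsNilpotent y → a * c * y = 0 := by
    intro a ha c
    have hc : c ∈ Submodule.span k (Units.val '' (Γ : Set Aˣ)) := hspan ▸ Submodule.mem_top
    induction hc using Submodule.span_induction with
    | mem c hc =>
      obtain ⟨γ, hγ, rfl⟩ := hc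
      intro y hy hny
      have h1 := ha _ (hconj γ hγ y hy) (isNilpotent_conj hny γ)
      rw [← mul_assoc, ← mul_assoc] at h1
      simpa using congrArg (· * (γ : A)) h1
    | zero => intro y _ _; rw [mul_zero, zero_mul]
    | add c d _ _ ihc ihd =>
      intro y hy hny
      rw [mul_add, add_mul, ihc y hy hny, ihd y hy hny, add_zero]
    | smul r c _ ihc =>
      intro y hy hny
      rw [mul_smul_comm, smul_mul_assoc, ihc y hy hny, smul_zero]
  let I : TwoSidedIdeal A := TwoSidedIdeal.mk' {a | ∀ y ∈ B, IsNilpotent y → a * y = 0}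
    (fun y _ _ => zero_mul y)
    (fun {a b} ha hb y hy hny => by rw [add_mul, ha y hy hny, hb y hy hny, add_zero])
    (fun {a} ha y hy hny => by rw [neg_mul, ha y hy hny, neg_zero])
    (fun {a b} hb y hy hny => by rw [mul_assoc, hb y hy hny, mul_zero])
    (fun {a b} ha => hright a ha b)
  have hI : ∀ a, a ∈ I ↔ ∀ y ∈ B, IsNilpotent y → a * y = 0 := fun a => TwoSidedIdeal.mem_mk' ..
  -- The annihilator cannot be zero: it contains the last nonzero power of the nilradical of `B`.
  rcases eq_bot_or_eq_top I with h | h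
  · exfalso
    let _ : CommRing B := { (inferInstance : Ring B) with
      mul_comm := fun a b => Subtype.ext (hcomm a a.2 b b.2) }
    have : IsNoetherianRing B := IsNoetherianRing.of_finite K B
    have hex := IsNoetherianRing.isNilpotent_nilradical B
    classical
    have hn := Nat.find_spec hex
    have hpos : Nat.find hex ≠ 0 := fun h0 => by
      rw [h0, pow_zero, Ideal.one_eq_top, Ideal.zero_eq_bot] at hn
      exact bot_ne_top hn.symm
    obtain ⟨m, hm⟩ := Nat.exists_eq_succ_of_ne_zero hpos
    refine Nat.find_min hex (m := m) (by omega) ?_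
    rw [Ideal.zero_eq_bot, eq_bot_iff]
    intro y hy
    have hyI : (y : A) ∈ I := (hI _).2 fun z hz hnz => by
      have hz' : (⟨z, hz⟩ : B) ∈ nilradical B := by
        obtain ⟨n, hn⟩ := hnz
        exact ⟨n, Subtype.ext hn⟩
      have h2 := Ideal.mul_mem_mul hy hz'
      rw [← pow_succ, ← Nat.succ_eq_add_one, ← hm, hn] at h2
      exact congrArg Subtype.val (Ideal.mem_bot.1 h2)
    rw [h] at hyI
    exact Ideal.mem_bot.2 (Subtype.ext hyI)
  · have h1 : (1 : A) ∈ I := h ▸ trivial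
    simpa using (hI 1).1 h1 x hx hnil

/-- A commutative finite-dimensional algebra has an idempotent `e ≠ 0` such that `e * f ∈ {0, e}`
for all idempotents `f`. -/
theorem exists_minimal_idempotent [FiniteDimensional K A] [Nontrivial A] {B : Subalgebra K A}
    (hcomm : ∀ a ∈ B, ∀ b ∈ B, a * b = b * a) :
    ∃ e ∈ B, IsIdempotentElem e ∧ e ≠ 0 ∧
      ∀ f ∈ B, IsIdempotentElem f → e * f = 0 ∨ e * f = e := by
  let P : Set A := {e | e ∈ B ∧ IsIdempotentElem e ∧ e ≠ 0}
  have hP : P.Nonempty := ⟨1, one_mem _, IsIdempotentElem.one, one_ne_zero⟩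
  let d : A → ℕ := fun e => Module.finrank K (LinearMap.range (LinearMap.mulLeft K e))
  -- Minimality is measured by the dimension of the right ideal `eA`.
  obtain ⟨e, ⟨heB, he, he0⟩, hmin⟩ := exists_minimalFor_of_wellFoundedLT (· ∈ P) d hP
  refine ⟨e, heB, he, he0, fun f hfB hf => ?_⟩
  by_cases h0 : e * f = 0
  · exact Or.inl h0
  right
  have hfe := hcomm e heB f hfB
  have hidem : IsIdempotentElem (e * f) := IsIdempotentElem.mul_of_commute hfe he hf
  have hle : LinearMap.range (LinearMap.mulLeft K (e * f)) ≤
      LinearMap.range (LinearMap.mulLeft K e) := by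
    rintro _ ⟨a, rfl⟩
    exact ⟨f * a, by simp⟩
  have heq : LinearMap.range (LinearMap.mulLeft K (e * f)) =
      LinearMap.range (LinearMap.mulLeft K e) :=
    Submodule.eq_of_le_of_finrank_le hle
      (hmin (j := e * f) ⟨mul_mem heB hfB, hidem, h0⟩ (Submodule.finrank_mono hle))
  obtain ⟨a, ha⟩ : e ∈ LinearMap.range (LinearMap.mulLeft K (e * f)) := by
    rw [heq]
    exact ⟨1, by simp⟩
  have ha' : e * f * a = e := ha
  calc e * f = f * e := hfe
    _ = f * (e * f * a) := by rw [ha']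
    _ = e * (f * f) * a := by rw [hfe, ← mul_assoc, ← mul_assoc, hf.eq, hfe]
    _ = e := by rw [hf.eq, ha']

/-- The descending powers of `b` stabilize, `b ^ (n + 1) * y = b ^ n`, which makes `b ^ n * y ^ n`
idempotent. If it is `0`, then `b` is nilpotent, hence zero; if it is `1`, then `b` is invertible.
-/
theorem isField_of_idempotents_trivial [FiniteDimensional K A] [Nontrivial A] {B : Subalgebra K A}
    (hcomm : ∀ a ∈ B, ∀ b ∈ B, a * b = b * a) (hred : ∀ x ∈ B, IsNilpotent x → x = 0)
    (hidem : ∀ f ∈ B, IsIdempotentElem f → f = 0 ∨ f = 1) : IsField B := by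
  refine ⟨⟨0, 1, zero_ne_one⟩, fun a b => Subtype.ext (hcomm a a.2 b b.2), fun {b} hb => ?_⟩
  let _ : CommRing B := { (inferInstance : Ring B) with
    mul_comm := fun a b => Subtype.ext (hcomm a a.2 b b.2) }
  have : IsArtinianRing B := IsArtinianRing.of_finite K B
  obtain ⟨n, y, hy⟩ := IsArtinian.exists_pow_succ_smul_dvd b (1 : B)
  have hy' : b ^ (n + 1) * y = b ^ n := by simpa using hy
  have hpow : ∀ m, b ^ (n + m) * y ^ m = b ^ n := by
    intro m
    induction m with
    | zero => simp
    | succ m ih =>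
      calc b ^ (n + (m + 1)) * y ^ (m + 1) = (b ^ (n + 1) * y) * b ^ m * y ^ m := by ring
        _ = b ^ (n + m) * y ^ m := by rw [hy']; ring
        _ = b ^ n := ih
  have hf : IsIdempotentElem (b ^ n * y ^ n) := by
    calc b ^ n * y ^ n * (b ^ n * y ^ n) = (b ^ (n + n) * y ^ n) * y ^ n := by ring
      _ = b ^ n * y ^ n := by rw [hpow]
  rcases hidem _ (b ^ n * y ^ n : B).2 (congrArg Subtype.val hf) with h | h
  · exfalso
    have h0 : b ^ n * y ^ n = 0 := Subtype.ext h
    have h1 : b ^ n = 0 := by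
      rw [← hpow n, pow_add, mul_assoc, h0, mul_zero]
    exact hb (Subtype.ext (hred b b.2 ⟨n, congrArg Subtype.val h1⟩))
  · have h1 : b ^ n * y ^ n = 1 := Subtype.ext h
    have hb1 : b * y = 1 := by
      calc b * y = (b ^ (n + 1) * y) * y ^ n := by
            rw [pow_succ, mul_comm (b ^ n) b, mul_assoc, mul_assoc, mul_comm y,
              ← mul_assoc (b ^ n), h1, one_mul]
        _ = 1 := by rw [hy', h1]
    exact ⟨y, hb1⟩

end NormalCommutativeSubalgebra

/-- If an abelian normal subgroup of `Γ` does not generate a field, then `A` is a matrix algebra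
over a proper corner that is again generated by a supersolvable group. -/
theorem exists_matrix_corner_of_not_isField {k K A : Type*} [Field k] [Field K] [Ring A]
    [Algebra K A] [Algebra k A] [FiniteDimensional K A] [Algebra.IsCentral K A] [IsSimpleRing A]
    {Γ : Subgroup Aˣ} (hss : IsSupersolvable Γ)
    (hfi : ((scalarUnits k A).subgroupOf Γ).FiniteIndex)
    (hgen : Algebra.adjoin k (Units.val '' (Γ : Set Aˣ)) = ⊤)
    {N : Subgroup Aˣ} (hN : ∀ γ ∈ Γ, ∀ x ∈ N, γ * x * γ⁻¹ ∈ N)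
    (hNcomm : ∀ x ∈ N, ∀ y ∈ N, x * y = y * x)
    (hfield : ¬ IsField (Algebra.adjoin K (Units.val '' (N : Set Aˣ)))) :
    ∃ (e : A) (he : IsIdempotentElem e) (n : ℕ), 1 < n ∧
      Nonempty (A ≃ₐ[K] Matrix (Fin n) (Fin n) he.Corner) ∧
      IsGeneratedBySupersolvable k he.Corner := by
  classical
  set B := Algebra.adjoin K (Units.val '' (N : Set Aˣ))
  have hcomm : ∀ a ∈ B, ∀ b ∈ B, a * b = b * a := fun a ha b hb => adjoin_units_comm hNcomm ha hb
  have hconj : ∀ γ ∈ Γ, ∀ b ∈ B, (γ : A) * b * (↑γ⁻¹ : A) ∈ B := fun γ hγ b hb =>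
    conj_mem_adjoin hN hγ hb
  have hspan := span_units_eq_top hgen
  have hred : ∀ x ∈ B, IsNilpotent x → x = 0 := fun x hx hnil =>
    eq_zero_of_isNilpotent_of_normalized hspan hcomm hconj hx hnil
  obtain ⟨e, heB, he, he0, hmin⟩ := exists_minimal_idempotent hcomm
  have he1 : e ≠ 1 := by
    rintro rfl
    exact hfield (isField_of_idempotents_trivial hcomm hred fun f hf hf' => by
      simpa using hmin f hf hf')
  have hidem : ∀ γ : Aˣ, IsIdempotentElem ((γ : A) * e * (↑γ⁻¹ : A)) := fun γ => by
    change γ * e * (↑γ⁻¹ : A) * (γ * e * (↑γ⁻¹ : A)) = _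
    rw [mul_assoc (γ * e : A), ← mul_assoc (↑γ⁻¹ : A), ← mul_assoc (↑γ⁻¹ : A), Units.inv_mul,
      one_mul, ← mul_assoc, mul_assoc (γ : A), he.eq]
  -- By minimality `e` is either orthogonal to its conjugate or below it; in the second case the
  -- same alternative for `γ⁻¹` forces equality.
  have hdich : ∀ γ ∈ Γ, (γ : A) * e = e * γ ∨ e * γ * e = 0 := by
    intro γ hγ
    rcases hmin _ (hconj γ hγ e heB) (hidem γ) with h | h
    · right
      calc e * γ * e = e * (γ * e * (↑γ⁻¹ : A)) * γ := by simp [mul_assoc]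
        _ = 0 := by rw [h, zero_mul]
    · left
      have hγ' := inv_mem hγ
      rcases hmin _ (hconj γ⁻¹ hγ' e heB) (hidem γ⁻¹) with h' | h'
      · exfalso
        apply he0
        rw [inv_inv] at h'
        calc e = (γ * e * (↑γ⁻¹ : A)) * e := by
              rw [← hcomm e heB _ (hconj γ hγ e heB), h]
          _ = γ * (e * ((↑γ⁻¹ : A) * e * γ)) * (↑γ⁻¹ : A) := by simp [mul_assoc]
          _ = 0 := by rw [h', mul_zero, zero_mul]
      · rw [inv_inv] at h'
        have h2 : γ * e * (↑γ⁻¹ : A) = e := by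
          calc γ * e * (↑γ⁻¹ : A) = γ * (e * ((↑γ⁻¹ : A) * e * γ)) * (↑γ⁻¹ : A) := by rw [h']
            _ = (γ * e * (↑γ⁻¹ : A)) * e := by simp [mul_assoc]
            _ = e := by rw [← hcomm e heB _ (hconj γ hγ e heB), h]
        calc (γ : A) * e = γ * e * (↑γ⁻¹ : A) * γ := by simp [mul_assoc]
          _ = e * γ := by rw [h2]
  let H : Subgroup Γ := (Submonoid.centralizer {e}).units.subgroupOf Γ
  have hHmem : ∀ γ : Γ, γ ∈ H ↔ ((γ : Aˣ) : A) * e = e * (γ : Aˣ) := by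
    intro γ
    constructor
    · intro h
      exact (Submonoid.mem_centralizer_iff.1 h.1 e rfl).symm
    · intro h
      refine Subgroup.mem_subgroupOf.2 ((Submonoid.mem_units_iff _ _).2 ⟨?_, ?_⟩)
      · exact Submonoid.mem_centralizer_iff.2 fun x hx => by rw [Set.mem_singleton_iff.1 hx, h]
      · refine Submonoid.mem_centralizer_iff.2 fun x hx => ?_
        rw [Set.mem_singleton_iff.1 hx, Units.eq_inv_mul_iff_mul_eq, ← mul_assoc, h, mul_assoc,
          Units.mul_inv, mul_one]
  have hHfi : H.FiniteIndex := by
    refine Subgroup.finiteIndex_of_le (H := (scalarUnits k A).subgroupOf Γ) ?_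
    rintro γ ⟨c, hc⟩
    have hc' : algebraMap k A c = ((γ : Aˣ) : A) := congrArg Units.val hc
    rw [hHmem, ← hc', Algebra.commutes]
  have : Fintype (Γ ⧸ H) := Fintype.ofFinite _
  let g : Γ ⧸ H → Aˣ := fun i => (i.out : Γ)
  let E : Γ ⧸ H → A := fun i => g i * e * (↑(g i)⁻¹ : A)
  -- The conjugate depends only on the coset modulo the stabilizer `H` of `e`, so `Γ` permutes the
  -- family `E`.
  have hE : ∀ γ : Γ, E (QuotientGroup.mk γ) = (γ : Aˣ) * e * (↑(γ : Aˣ)⁻¹ : A) := by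
    intro γ
    obtain ⟨⟨h, hh⟩, h1⟩ := QuotientGroup.mk_out_eq_mul H γ
    simp only [E, g, h1, Subgroup.coe_mul, Units.val_mul, mul_inv_rev]
    rw [mul_assoc ((γ : Aˣ) : A), (hHmem h).1 hh]
    simp [mul_assoc]
  have hEconj : ∀ (γ : Γ) (i : Γ ⧸ H), (γ : Aˣ) * E i * (↑(γ : Aˣ)⁻¹ : A) = E (γ • i) := by
    intro γ i
    obtain ⟨x, rfl⟩ := QuotientGroup.mk_surjective i
    rw [MulAction.Quotient.smul_coe, hE, hE]
    simp [mul_assoc]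
  have hortho : ∀ i j, i ≠ j → e * ((↑(g i)⁻¹ : A) * g j) * e = 0 := by
    intro i j hij
    have hmem : (g i)⁻¹ * g j ∈ Γ := mul_mem (inv_mem (i.out : Γ).2) (j.out : Γ).2
    rcases hdich _ hmem with h | h
    · exfalso
      apply hij
      have h2 : (i.out : Γ)⁻¹ * j.out ∈ H := (hHmem _).2 h
      rw [← QuotientGroup.out_eq' i, ← QuotientGroup.out_eq' j]
      exact QuotientGroup.eq.2 h2
    · exact h
  have hsum : ∑ i, E i = 1 := by
    have hΓ : ∀ γ ∈ Γ, (γ : A) * ∑ i, E i = (∑ i, E i) * γ := by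
      intro γ hγ
      have h1 : (γ : A) * (∑ i, E i) * (↑γ⁻¹ : A) = ∑ i, E i := by
        rw [Finset.mul_sum, Finset.sum_mul]
        exact (Finset.sum_congr rfl fun i _ => hEconj ⟨γ, hγ⟩ i).trans
          (Equiv.sum_comp (MulAction.toPerm (⟨γ, hγ⟩ : Γ)) E)
      calc (γ : A) * ∑ i, E i = (γ : A) * (∑ i, E i) * (↑γ⁻¹ : A) * γ := by simp [mul_assoc]
        _ = (∑ i, E i) * γ := by rw [h1]
    have hcentral : ∑ i, E i ∈ Subalgebra.center K A := by
      rw [Subalgebra.mem_center_iff]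
      intro b
      have hb : b ∈ Submodule.span k (Units.val '' (Γ : Set Aˣ)) := hspan ▸ Submodule.mem_top
      induction hb using Submodule.span_induction with
      | mem c hc =>
        obtain ⟨γ, hγ, rfl⟩ := hc
        exact hΓ γ hγ
      | zero => rw [zero_mul, mul_zero]
      | add x y _ _ ihx ihy => rw [add_mul, mul_add, ihx, ihy]
      | smul r x _ ihx => rw [smul_mul_assoc, mul_smul_comm, ihx]
    obtain ⟨c, hc⟩ := Algebra.mem_bot.1 (Algebra.IsCentral.out (K := K) hcentral)
    have hone : E (QuotientGroup.mk 1) = e := by rw [hE]; simp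
    -- By orthogonality only the trivial coset contributes; the sum is a central scalar fixing `e ≠
    -- 0`, hence `1`.
    have hse : (∑ i, E i) * e = e := by
      rw [Finset.sum_mul, Finset.sum_eq_single (QuotientGroup.mk 1 : Γ ⧸ H)]
      · rw [hone, he.eq]
      · intro i _ hi
        have h1 := hortho i _ hi
        have h2 : e * (↑(g i)⁻¹ : A) * E (QuotientGroup.mk 1) = 0 := by
          calc e * (↑(g i)⁻¹ : A) * E (QuotientGroup.mk 1)
              = e * ((↑(g i)⁻¹ : A) * g (QuotientGroup.mk 1)) * e *
                (↑(g (QuotientGroup.mk 1))⁻¹ : A) := by simp only [E, mul_assoc]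
            _ = 0 := by rw [h1, zero_mul]
        rw [hone] at h2
        calc E i * e = g i * (e * (↑(g i)⁻¹ : A) * e) := by simp only [E, mul_assoc]
          _ = 0 := by rw [h2, mul_zero]
      · intro h
        exact absurd (Finset.mem_univ _) h
    have hc1 : c = 1 := by
      rw [← hc, ← Algebra.smul_def] at hse
      have h0 : (c - 1) • e = 0 := by rw [sub_smul, one_smul, hse, sub_self]
      rcases smul_eq_zero.1 h0 with h | h
      · exact sub_eq_zero.1 h
      · exact absurd h he0
    rw [← hc, hc1, map_one]
  have hcard : 1 < Fintype.card (Γ ⧸ H) := by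
    by_contra hlt
    have hsub : Subsingleton (Γ ⧸ H) := Fintype.card_le_one_iff_subsingleton.1 (not_lt.1 hlt)
    apply he1
    have hone : E (QuotientGroup.mk 1) = e := by rw [hE]; simp
    rw [← hsum, Fintype.sum_subsingleton E (QuotientGroup.mk 1), hone]
  obtain ⟨φ⟩ := nonempty_algEquiv_matrix_corner (K := K) he g hortho hsum
  exact ⟨e, he, _, hcard,
    ⟨φ.trans (Matrix.reindexAlgEquiv K he.Corner (Fintype.equivFin (Γ ⧸ H)))⟩,
    isGeneratedBySupersolvable_corner he hss hfi hgen hdich⟩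

/-! ### Recognizing a crossed product. -/

section CrossedProductStructure

variable {k K L A : Type*} [Field k] [Field K] [Field L] [Algebra K L] [Ring A] [Algebra K A]
  [Algebra k A]

/-- Multiplying the relation by `ι x` on the right and applying an `L`-linear functional that does
not vanish at `u τ` gives a linear relation among the automorphisms of `L`; Dedekind's independence
of characters kills its coefficients. -/
theorem eq_zero_of_sum_induces_eq_zero {ι : L →ₐ[K] A} [FiniteDimensional K L] [Nontrivial A]
    {u : (L ≃ₐ[K] L) → Aˣ} (hu : ∀ σ, Induces ι (u σ) σ) {c : (L ≃ₐ[K] L) → L}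
    (hc : ∑ σ, ι (c σ) * (u σ : A) = 0) : c = 0 := by
  let _ : Module L A := Module.compHom A (ι : L →+* A)
  have hsmul : ∀ (l : L) (a : A), l • a = ι l * a := fun _ _ => rfl
  funext τ
  have hne : ∃ φ : Module.Dual L A, φ (u τ : A) ≠ 0 := by
    by_contra! h
    exact (u τ).ne_zero ((Module.forall_dual_apply_eq_zero_iff L _).1 h)
  obtain ⟨φ, hφ⟩ := hne
  have hx : ∀ x : L, ∑ σ : L ≃ₐ[K] L, (c σ * φ (u σ : A)) * σ x = 0 := by
    intro x
    have h1 : (∑ σ, ι (c σ) * (u σ : A)) * ι x = ∑ σ, (c σ * σ x) • (u σ : A) := by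
      rw [Finset.sum_mul]
      refine Finset.sum_congr rfl fun σ _ => ?_
      rw [mul_assoc, hu σ x, hsmul, map_mul, mul_assoc]
    rw [hc, zero_mul] at h1
    have h2 := congrArg φ h1
    rw [map_zero, map_sum] at h2
    rw [h2]
    refine Finset.sum_congr rfl fun σ _ => ?_
    rw [map_smul, smul_eq_mul]
    ring
  have hli : LinearIndependent L (fun σ : L ≃ₐ[K] L => (σ : L → L)) :=
    (linearIndependent_monoidHom L L).comp
      (fun σ : L ≃ₐ[K] L => ((σ : L →ₐ[K] L) : L →* L)) fun σ τ h => by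
        ext x
        exact DFunLike.congr_fun h x
  have h0 := Fintype.linearIndependent_iff.1 hli (fun σ => c σ * φ (u σ : A)) (by
    funext x
    simpa using hx x) τ
  exact (mul_eq_zero.1 h0).resolve_right hφ

theorem exists_induces_of_conj_mem_range {ι : L →ₐ[K] A} [FiniteDimensional K L] [Nontrivial A]
    {γ : Aˣ} (hγ : ∀ l, (γ : A) * ι l * (↑γ⁻¹ : A) ∈ ι.range) : ∃ σ, Induces ι γ σ := by
  choose s hs using hγ
  have hs' : ∀ l, ι (s l) = (γ : A) * ι l * (↑γ⁻¹ : A) := hs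
  have hinj : Function.Injective ι := ι.injective
  let f : L →ₐ[K] L :=
    { toFun := s
      map_one' := hinj (by rw [hs', map_one, mul_one, Units.mul_inv])
      map_mul' := fun x y => hinj (by
        rw [hs', map_mul, map_mul, hs', hs']
        simp only [mul_assoc, Units.inv_mul_cancel_left])
      map_zero' := hinj (by rw [hs', map_zero, mul_zero, zero_mul])
      map_add' := fun x y => hinj (by rw [hs', map_add, map_add, hs', hs', mul_add, add_mul])
      commutes' := fun r => hinj (by
        rw [hs', ι.commutes, ← Algebra.commutes, mul_assoc, Units.mul_inv, mul_one]) }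
  refine ⟨AlgEquiv.ofBijective f f.bijective, fun l => ?_⟩
  change (γ : A) * ι l = ι (s l) * γ
  rw [hs', mul_assoc, Units.inv_mul, mul_one]

/-- An element of `L` fixed by all induced automorphisms commutes with a spanning set of `A`, so it
lies in the center `K`. The Galois correspondence then shows that every automorphism is induced. -/
theorem isGalois_and_surjective_of_induces {ι : L →ₐ[K] A} [FiniteDimensional K L]
    [Nontrivial A] [Algebra.IsCentral K A] {Γ : Subgroup Aˣ}
    (hspan : Submodule.span k (Units.val '' (Γ : Set Aˣ)) = ⊤)
    (hΓ : ∀ γ ∈ Γ, ∃ σ, Induces ι γ σ) :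
    IsGalois K L ∧ ∀ σ, ∃ γ ∈ Γ, Induces ι γ σ := by
  let G : Subgroup (L ≃ₐ[K] L) :=
    { carrier := {σ | ∃ γ ∈ Γ, Induces ι γ σ}
      one_mem' := ⟨1, one_mem _, fun l => by simp⟩
      mul_mem' := by
        rintro σ τ ⟨γ, hγ, h⟩ ⟨γ', hγ', h'⟩
        exact ⟨γ * γ', mul_mem hγ hγ', h.mul h'⟩
      inv_mem' := by
        rintro σ ⟨γ, hγ, h⟩
        exact ⟨γ⁻¹, inv_mem hγ, h.inv⟩ }
  have hG : IntermediateField.fixedField G = ⊥ := by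
    rw [eq_bot_iff]
    intro l hl
    rw [IntermediateField.mem_fixedField_iff] at hl
    have hcentral : ι l ∈ Subalgebra.center K A := by
      rw [Subalgebra.mem_center_iff]
      intro b
      have hb : b ∈ Submodule.span k (Units.val '' (Γ : Set Aˣ)) := hspan ▸ Submodule.mem_top
      induction hb using Submodule.span_induction with
      | mem c hc =>
        obtain ⟨γ, hγ, rfl⟩ := hc
        obtain ⟨σ, hσ⟩ := hΓ γ hγ
        rw [hσ l, hl σ ⟨γ, hγ, hσ⟩]
      | zero => rw [zero_mul, mul_zero]
      | add x y _ _ ihx ihy => rw [add_mul, mul_add, ihx, ihy]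
      | smul r x _ ihx => rw [smul_mul_assoc, mul_smul_comm, ihx]
    obtain ⟨c, hc⟩ := Algebra.mem_bot.1 (Algebra.IsCentral.out (K := K) hcentral)
    have hinj : Function.Injective ι := ι.injective
    refine IntermediateField.mem_bot.2 ⟨c, hinj ?_⟩
    rw [ι.commutes, hc]
  have htop : G = ⊤ := by
    rw [← IntermediateField.fixingSubgroup_fixedField G, hG, IntermediateField.fixingSubgroup_bot]
  refine ⟨IsGalois.of_fixedField_eq_bot K L (by rw [← htop, hG]), fun σ => ?_⟩
  have : σ ∈ G := htop ▸ Subgroup.mem_top σ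
  exact this

/-- Let `N` be an abelian normal subgroup of `Γ` that contains the commutators of `Γ`, is its own
centralizer and generates a field `L`. If `Γ` generates `A`, then `A` is a crossed product of `L`
with abelian Galois group and a cocycle of radicals. -/
theorem exists_crossedProduct_of_self_centralizing [Algebra k K] [Algebra k L]
    [IsScalarTower k K L] [IsScalarTower k K A] {ι : L →ₐ[K] A} [FiniteDimensional K L]
    [Nontrivial A] [Algebra.IsCentral K A] {Γ N : Subgroup Aˣ}
    (hfi : ((scalarUnits k A).subgroupOf Γ).FiniteIndex)
    (hspan : Submodule.span k (Units.val '' (Γ : Set Aˣ)) = ⊤) (hNΓ : N ≤ Γ)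
    (hN : ∀ γ ∈ Γ, ∀ x ∈ N, γ * x * γ⁻¹ ∈ N)
    (hself : ∀ γ ∈ Γ, (∀ x ∈ N, γ * x = x * γ) → γ ∈ N)
    (hcom : ∀ γ ∈ Γ, ∀ γ' ∈ Γ, γ * γ' * γ⁻¹ * γ'⁻¹ ∈ N)
    (hι : ι.range = Algebra.adjoin K (Units.val '' (N : Set Aˣ))) :
    ∃ t : (L ≃ₐ[K] L) × (L ≃ₐ[K] L) → Lˣ,
      IsRadicalExtension k L ∧ (∀ p, t p ∈ radGroup k L) ∧ IsCrossedProduct K L A t ∧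
        ∀ σ τ : L ≃ₐ[K] L, σ * τ = τ * σ := by
  have hinj : Function.Injective ι := ι.injective
  have hind : ∀ γ ∈ Γ, ∃ σ, Induces ι γ σ := fun γ hγ => by
    refine exists_induces_of_conj_mem_range fun l => ?_
    rw [hι]
    refine conj_mem_adjoin hN hγ ?_
    rw [← hι]
    exact ⟨l, rfl⟩
  obtain ⟨hgal, hsurj⟩ := isGalois_and_surjective_of_induces hspan hind
  choose u huΓ hu using hsurj
  have hlift : ∀ x ∈ N, ∃ l : Lˣ, Units.map (ι : L →* A) l = x := by
    intro x hx
    obtain ⟨l, hl⟩ : (x : A) ∈ ι.range := by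
      rw [hι]
      exact Algebra.subset_adjoin ⟨x, hx, rfl⟩
    have hl' : ι l = x := hl
    have hl0 : l ≠ 0 := by
      rintro rfl
      rw [map_zero] at hl'
      exact x.ne_zero hl'.symm
    exact ⟨Units.mk0 l hl0, Units.ext hl'⟩
  have hone : ∀ γ ∈ Γ, Induces ι γ (1 : L ≃ₐ[K] L) → γ ∈ N := by
    intro γ hγ h
    refine hself γ hγ fun x hx => ?_
    obtain ⟨l, rfl⟩ := hlift x hx
    exact Units.ext (h l)
  have hrad : ∀ l : Lˣ, Units.map (ι : L →* A) l ∈ N → l ∈ radGroup k L := by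
    intro l hl
    obtain ⟨n, hn, -, h⟩ := Subgroup.exists_pow_mem_of_index_ne_zero hfi.index_ne_zero
      ⟨_, hNΓ hl⟩
    obtain ⟨c, hc⟩ := Subgroup.mem_subgroupOf.1 h
    refine ⟨n, hn, c, Units.ext (hinj ?_)⟩
    have hc' : algebraMap k A c = ι l ^ n := congrArg Units.val hc
    change ι (algebraMap k L c) = ι ((l ^ n : Lˣ) : L)
    rw [IsScalarTower.algebraMap_apply k K L, ι.commutes, ← IsScalarTower.algebraMap_apply, hc',
      Units.val_pow_eq_pow_val, map_pow]
  have htex : ∀ p : (L ≃ₐ[K] L) × (L ≃ₐ[K] L), ∃ l : Lˣ, Units.map (ι : L →* A) l ∈ N ∧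
      u p.1 * u p.2 = Units.map (ι : L →* A) l * u (p.1 * p.2) := by
    rintro ⟨σ, τ⟩
    have hmem : u σ * u τ * (u (σ * τ))⁻¹ ∈ N := by
      refine hone _ (mul_mem (mul_mem (huΓ _) (huΓ _)) (inv_mem (huΓ _))) ?_
      have := ((hu σ).mul (hu τ)).mul (hu (σ * τ)).inv
      rwa [mul_inv_cancel] at this
    obtain ⟨l, hl⟩ := hlift _ hmem
    exact ⟨l, hl ▸ hmem, by rw [hl, inv_mul_cancel_right]⟩
  choose t htN ht using htex
  have htrad : ∀ p, t p ∈ radGroup k L := fun p => hrad _ (htN p)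
  -- `R` is `k[N]`, a priori smaller than `L = K[N]`; coefficients in `R` suffice because `Γ` spans
  -- `A` over `k`.
  let R : Subalgebra k L := Algebra.adjoin k {l | ∃ x ∈ N, ι l = x}
  have hR : ∀ a : A, ∃ c : (L ≃ₐ[K] L) → L, (∀ σ, c σ ∈ R) ∧ ∑ σ, ι (c σ) * (u σ : A) = a := by
    intro a
    have ha : a ∈ Submodule.span k (Units.val '' (Γ : Set Aˣ)) := hspan ▸ Submodule.mem_top
    induction ha using Submodule.span_induction with
    | mem a ha =>
      classical
      obtain ⟨γ, hγ, rfl⟩ := ha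
      obtain ⟨σ, hσ⟩ := hind γ hγ
      have hmem : γ * (u σ)⁻¹ ∈ N := by
        refine hone _ (mul_mem hγ (inv_mem (huΓ σ))) ?_
        have := hσ.mul (hu σ).inv
        rwa [mul_inv_cancel] at this
      obtain ⟨l, hl⟩ := hlift _ hmem
      refine ⟨Pi.single σ (l : L), fun τ => ?_, ?_⟩
      · by_cases h : τ = σ
        · subst h
          rw [Pi.single_eq_same]
          exact Algebra.subset_adjoin ⟨_, hmem, congrArg Units.val hl⟩
        · rw [Pi.single_eq_of_ne h]
          exact zero_mem _
      · rw [Finset.sum_eq_single σ]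
        · rw [Pi.single_eq_same]
          have := congrArg Units.val (eq_mul_inv_iff_mul_eq.1 hl)
          exact this
        · intro τ _ h
          rw [Pi.single_eq_of_ne h, map_zero, zero_mul]
        · exact fun h => absurd (Finset.mem_univ _) h
    | zero => exact ⟨0, fun _ => zero_mem _, by simp⟩
    | add x y _ _ ihx ihy =>
      obtain ⟨c, hc, rfl⟩ := ihx
      obtain ⟨d, hd, rfl⟩ := ihy
      exact ⟨c + d, fun σ => add_mem (hc σ) (hd σ), by
        simp [add_mul, Finset.sum_add_distrib]⟩
    | smul r x _ ihx =>
      obtain ⟨c, hc, rfl⟩ := ihx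
      refine ⟨r • c, fun σ => Subalgebra.smul_mem _ (hc σ) r, ?_⟩
      rw [Finset.smul_sum]
      refine Finset.sum_congr rfl fun σ _ => ?_
      rw [Pi.smul_apply, ← smul_mul_assoc]
      congr 1
      exact (ι.toLinearMap.restrictScalars k).map_smul r (c σ)
  have hbij : Function.Bijective (fun c : (L ≃ₐ[K] L) → L => ∑ σ, ι (c σ) * (u σ : A)) := by
    refine ⟨fun c d hcd => ?_, fun a => ?_⟩
    · rw [← sub_eq_zero]
      refine eq_zero_of_sum_induces_eq_zero hu ?_
      simp only [Pi.sub_apply, map_sub, sub_mul, Finset.sum_sub_distrib]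
      exact sub_eq_zero.2 hcd
    · obtain ⟨c, -, hc⟩ := hR a
      exact ⟨c, hc⟩
  have hu1 : u 1 ∈ N := hone _ (huΓ 1) (hu 1)
  obtain ⟨n, hn⟩ := hlift _ hu1
  refine ⟨t, ?_, htrad, ⟨hgal, ?_, ι, u, hbij, fun σ x => hu σ x, fun σ τ => ?_⟩, fun σ τ => ?_⟩
  -- By uniqueness, the expansion of `ι l` with coefficients in `R` is the one supported at `1`.
  -- Hence `l` is an element of `R` times the radical `n` with `ι n = u 1`; no finiteness of `K/k`
  -- is needed.
  · rw [IsRadicalExtension, eq_top_iff]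
    rintro l -
    have hRle : ∀ r ∈ R, r ∈ IntermediateField.adjoin k (Units.val '' (radGroup k L : Set Lˣ)) := by
      intro r hr
      have hle : R ≤
          (IntermediateField.adjoin k (Units.val '' (radGroup k L : Set Lˣ))).toSubalgebra := by
        refine Algebra.adjoin_le ?_
        rintro l ⟨x, hx, hlx⟩
        obtain ⟨l', rfl⟩ := hlift x hx
        obtain rfl : l = l' := hinj hlx
        exact IntermediateField.subset_adjoin k _ ⟨l', hrad l' hx, rfl⟩
      exact hle hr
    classical
    obtain ⟨c, hc, hcl⟩ := hR (ι l)
    have h1 : c = Pi.single 1 (l * ((n⁻¹ : Lˣ) : L)) := by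
      apply hbij.1
      change ∑ σ, ι (c σ) * (u σ : A) =
        ∑ σ, ι ((Pi.single 1 (l * ((n⁻¹ : Lˣ) : L)) : (L ≃ₐ[K] L) → L) σ) * (u σ : A)
      rw [hcl, Finset.sum_eq_single 1]
      · have hn' : ι (n : L) = u 1 := congrArg Units.val hn
        rw [Pi.single_eq_same, ← hn', ← map_mul, mul_assoc, Units.inv_mul, mul_one]
      · intro τ _ h
        rw [Pi.single_eq_of_ne h, map_zero, zero_mul]
      · exact fun h => absurd (Finset.mem_univ _) h
    have h2 : l = c 1 * n := by
      rw [h1, Pi.single_eq_same, mul_assoc, Units.inv_mul, mul_one]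
    rw [h2]
    exact mul_mem (hRle _ (hc 1))
      (IntermediateField.subset_adjoin k _ ⟨n, hrad n (hn ▸ hu1), rfl⟩)
  · intro σ τ ρ
    have hinj' : Function.Injective (Units.map (ι : L →* A)) := fun x y h =>
      Units.ext (hinj (congrArg Units.val h))
    refine hinj' (mul_right_cancel (b := u (σ * τ * ρ)) ?_)
    have hσ : u σ * Units.map (ι : L →* A) (t (τ, ρ)) =
        Units.map (ι : L →* A) (σ • t (τ, ρ)) * u σ := unit_mul_map_eq (fun σ x => hu σ x) σ _
    have e1 : u σ * u τ * u ρ =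
        Units.map (ι : L →* A) (t (σ * τ, ρ) * t (σ, τ)) * u (σ * τ * ρ) := by
      rw [ht (σ, τ), mul_assoc, ht (σ * τ, ρ), ← mul_assoc, ← map_mul, mul_comm (t (σ, τ))]
    have e2 : u σ * u τ * u ρ =
        Units.map (ι : L →* A) (σ • t (τ, ρ) * t (σ, τ * ρ)) * u (σ * τ * ρ) := by
      rw [mul_assoc, ht (τ, ρ), ← mul_assoc, hσ, mul_assoc, ht (σ, τ * ρ), ← mul_assoc, ← map_mul,
        mul_assoc σ τ ρ]
    exact e1.symm.trans e2
  · exact congrArg Units.val (ht (σ, τ))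
  -- The commutator of the lifts lies in `N`, so it induces the identity on `L`.
  · obtain ⟨l, hl⟩ := hlift _ (hcom (u σ) (huΓ σ) (u τ) (huΓ τ))
    have h1 : Induces ι (u σ * u τ * (u σ)⁻¹ * (u τ)⁻¹) (σ * τ * σ⁻¹ * τ⁻¹) :=
      (((hu σ).mul (hu τ)).mul (hu σ).inv).mul (hu τ).inv
    have h2 := h1.unique (hl ▸ induces_map l)
    rwa [mul_inv_eq_one, mul_inv_eq_iff_eq_mul] at h2

end CrossedProductStructure

theorem exists_field_of_isField {k : Type u} {K : Type v} {A : Type w} [Field k] [Field K]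
    [Algebra k K] [Ring A] [Algebra K A] {B : Subalgebra K A} (hB : IsField B) :
    ∃ (L : Type w) (_ : Field L) (_ : Algebra K L) (_ : Algebra k L) (_ : IsScalarTower k K L)
      (ι : L →ₐ[K] A), ι.range = B := by
  let _ : Field B := hB.toField
  let _ : Algebra K B := B.algebra
  let _ : Algebra k B := ((algebraMap K B).comp (algebraMap k K)).toAlgebra
  exact ⟨B, inferInstance, inferInstance, inferInstance,
    IsScalarTower.of_algebraMap_eq fun _ => rfl, B.val, B.range_val⟩

/-! ### The case where all abelian normal subgroups generate fields. -/

section Primitive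

variable {k : Type u} {K : Type v} {A : Type w} [Field k] [Field K] [Algebra k K] [Ring A]
  [Algebra K A] [Algebra k A] [IsSimpleRing A]

/-- A self-centralizing abelian `N` inside the finite group `Γ'` is a finite subgroup of a field,
thus cyclic. Then `Γ'` centralizes it, which forces `Γ' = N`. -/
theorem commutator_comm_of_fields {Γ : Subgroup Aˣ} (hss : IsSupersolvable Γ)
    (hfi : ((scalarUnits k A).subgroupOf Γ).FiniteIndex)
    (hfield : ∀ N : Subgroup Γ, N.Normal → (∀ x ∈ N, ∀ y ∈ N, x * y = y * x) →
      IsField (Algebra.adjoin K (Units.val '' (N.map Γ.subtype : Set Aˣ)))) :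
    ∀ x ∈ commutator Γ, ∀ y ∈ commutator Γ, x * y = y * x := by
  have hcenter : (scalarUnits k A).subgroupOf Γ ≤ Subgroup.center Γ := by
    rintro z ⟨c, hc⟩
    rw [Subgroup.mem_center_iff]
    intro g
    have hc' : algebraMap k A c = ((z : Aˣ) : A) := congrArg Units.val hc
    refine Subtype.ext (Units.ext ?_)
    change ((g : Aˣ) : A) * ((z : Aˣ) : A) = ((z : Aˣ) : A) * ((g : Aˣ) : A)
    rw [← hc', Algebra.commutes]
  have := finite_commutator_of_finiteIndex_le_center hcenter
  obtain ⟨N, hN, -, hND, hNcomm, hself⟩ := hss.exists_self_centralizing (D := commutator Γ)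
    (N₀ := ⊥) inferInstance inferInstance bot_le (by simp)
  have hfin : Finite N := Finite.of_injective _ (Subgroup.inclusion_injective hND)
  have hcyc : IsCyclic N := by
    obtain ⟨L, _, _, _, _, ι, hι⟩ := exists_field_of_isField (k := k) (hfield N hN hNcomm)
    have hmem : ∀ x : N, ∃ l : L, ι l = ((x : Γ) : Aˣ) := fun x => by
      have : (((x : Γ) : Aˣ) : A) ∈ ι.range := by
        rw [hι]
        exact Algebra.subset_adjoin ⟨_, ⟨x, x.2, rfl⟩, rfl⟩
      exact this
    choose f hf using hmem
    have hinj : Function.Injective ι := ι.injective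
    let F : N →* L :=
      { toFun := f
        map_one' := hinj (by rw [hf, map_one]; rfl)
        map_mul' := fun x y => hinj (by rw [hf, map_mul, hf, hf]; rfl) }
    refine isCyclic_of_injective_ringHom F fun x y h => ?_
    have h1 : f x = f y := h
    have h2 := congrArg ι h1
    rw [hf, hf] at h2
    exact Subtype.ext (Subtype.ext (Units.ext h2))
  intro x hx y hy
  have hle : ∀ z ∈ commutator Γ, z ∈ N := fun z hz =>
    hself z hz fun y hy => commutator_commute_of_isCyclic hz hy
  exact hNcomm x (hle x hx) y (hle y hy)

theorem isRadicalAbelianOver_of_fields [IsScalarTower k K A] [FiniteDimensional K A]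
    [Algebra.IsCentral K A] {Γ : Subgroup Aˣ} (hss : IsSupersolvable Γ)
    (hfi : ((scalarUnits k A).subgroupOf Γ).FiniteIndex)
    (hgen : Algebra.adjoin k (Units.val '' (Γ : Set Aˣ)) = ⊤)
    (hfield : ∀ N : Subgroup Γ, N.Normal → (∀ x ∈ N, ∀ y ∈ N, x * y = y * x) →
      IsField (Algebra.adjoin K (Units.val '' (N.map Γ.subtype : Set Aˣ)))) :
    IsRadicalAbelianOver k K A := by
  obtain ⟨N, hN, hcN, -, hNcomm, hself⟩ := hss.exists_self_centralizing (D := ⊤)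
    (N₀ := commutator Γ) inferInstance inferInstance le_top
    (commutator_comm_of_fields hss hfi hfield)
  obtain ⟨L, hLf, hKL, hkL, htower, ι, hι⟩ :=
    exists_field_of_isField (k := k) (hfield N hN hNcomm)
  have hfd : FiniteDimensional K L := FiniteDimensional.of_injective ι.toLinearMap ι.injective
  have hnorm : ∀ γ ∈ Γ, ∀ x ∈ N.map Γ.subtype, γ * x * γ⁻¹ ∈ N.map Γ.subtype := by
    rintro γ hγ _ ⟨x, hx, rfl⟩
    exact ⟨_, hN.conj_mem x hx ⟨γ, hγ⟩, rfl⟩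
  have hcent : ∀ γ ∈ Γ, (∀ x ∈ N.map Γ.subtype, γ * x = x * γ) → γ ∈ N.map Γ.subtype := by
    intro γ hγ h
    refine ⟨⟨γ, hγ⟩, hself _ (Subgroup.mem_top _) fun y hy => ?_, rfl⟩
    exact Subtype.ext (h y ⟨y, hy, rfl⟩)
  have hcom : ∀ γ ∈ Γ, ∀ γ' ∈ Γ, γ * γ' * γ⁻¹ * γ'⁻¹ ∈ N.map Γ.subtype := by
    intro γ hγ γ' hγ'
    exact ⟨⁅(⟨γ, hγ⟩ : Γ), ⟨γ', hγ'⟩⁆,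
      hcN (Subgroup.commutator_mem_commutator (Subgroup.mem_top _) (Subgroup.mem_top _)), rfl⟩
  obtain ⟨t, h⟩ := exists_crossedProduct_of_self_centralizing (k := k) hfi (span_units_eq_top hgen)
    (Subgroup.map_subtype_le N) hnorm hcent hcom hι
  exact ⟨L, hLf, hKL, hkL, htower, hfd, t, h⟩

end Primitive

theorem nonempty_algEquiv_matrix_one {K A : Type*} [Field K] [Ring A] [Algebra K A] :
    Nonempty (A ≃ₐ[K] Matrix (Fin 1) (Fin 1) A) :=
  ⟨{ toFun := fun a => Matrix.diagonal fun _ => a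
     invFun := fun M => M 0 0
     left_inv := fun _ => rfl
     right_inv := fun M => by
      ext i j
      rw [Subsingleton.elim i 0, Subsingleton.elim j 0]
      rfl
     map_mul' := fun a b => (Matrix.diagonal_mul_diagonal _ _).symm
     map_add' := fun a b => (Matrix.diagonal_add _ _).symm
     commutes' := fun _ => rfl }⟩

/-- Every central simple algebra generated by a supersolvable group of units that is finite modulo
scalars is a matrix algebra over a radical abelian algebra. -/
theorem IsGeneratedBySupersolvable.exists_matrix_radicalAbelian {k : Type u} {K : Type v}
    [Field k] [Field K] [Algebra k K] (d : ℕ) :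
    ∀ (A : Type w) [Ring A] [Algebra K A] [Algebra k A] [IsScalarTower k K A]
      [FiniteDimensional K A] [Algebra.IsCentral K A] [IsSimpleRing A],
      Module.finrank K A = d → IsGeneratedBySupersolvable k A →
      ∃ (n : ℕ) (C : Type w) (_ : Ring C) (_ : Algebra K C),
        0 < n ∧ FiniteDimensional K C ∧ Algebra.IsCentral K C ∧ IsSimpleRing C ∧
          IsRadicalAbelianOver k K C ∧ Nonempty (A ≃ₐ[K] Matrix (Fin n) (Fin n) C) := by
  induction d using Nat.strong_induction_on with
  | _ d ih =>
  intro A _ _ _ _ _ _ _ hd h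
  obtain ⟨Γ, hss, hfi, hgen⟩ := h
  by_cases hfield : ∀ N : Subgroup Γ, N.Normal → (∀ x ∈ N, ∀ y ∈ N, x * y = y * x) →
      IsField (Algebra.adjoin K (Units.val '' (N.map Γ.subtype : Set Aˣ)))
  · exact ⟨1, A, inferInstance, inferInstance, one_pos, inferInstance, inferInstance,
      inferInstance, isRadicalAbelianOver_of_fields hss hfi hgen hfield,
      nonempty_algEquiv_matrix_one⟩
  · push Not at hfield
    obtain ⟨N, hN, hNcomm, hnot⟩ := hfield
    obtain ⟨e, he, n, hn, ⟨φ⟩, hgen'⟩ := exists_matrix_corner_of_not_isField (K := K) hss hfi hgen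
      (N := N.map Γ.subtype)
      (by
        rintro γ hγ _ ⟨x, hx, rfl⟩
        exact ⟨_, hN.conj_mem x hx ⟨γ, hγ⟩, rfl⟩)
      (by
        rintro _ ⟨x, hx, rfl⟩ _ ⟨y, hy, rfl⟩
        exact congrArg Subtype.val (hNcomm x hx y hy)) hnot
    have : NeZero n := ⟨by omega⟩
    have hMsimple : IsSimpleRing (Matrix (Fin n) (Fin n) he.Corner) :=
      IsSimpleRing.of_ringEquiv φ.toRingEquiv inferInstance
    have hsimple : IsSimpleRing he.Corner := isSimpleRing_of_matrix (I := Fin n)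
    have hMcentral : Algebra.IsCentral K (Matrix (Fin n) (Fin n) he.Corner) :=
      Algebra.IsCentral.of_algEquiv K A _ φ
    have hcentral : Algebra.IsCentral K he.Corner := isCentral_of_matrix (I := Fin n) hMcentral
    -- The dimension of `A` is `n ^ 2` times that of the corner, and `n > 1`.
    have hlt : Module.finrank K he.Corner < d := by
      have h1 := φ.toLinearEquiv.finrank_eq
      rw [hd, Module.finrank_matrix, Fintype.card_fin] at h1
      have h2 : 0 < Module.finrank K he.Corner := Module.finrank_pos
      have h3 : 2 ≤ n * n := by nlinarith
      have h4 := Nat.mul_le_mul_right (Module.finrank K he.Corner) h3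
      omega
    obtain ⟨m, C, hCr, hCa, hm, hC1, hC2, hC3, hC4, ⟨ψ⟩⟩ := ih _ hlt he.Corner rfl hgen'
    refine ⟨n * m, C, hCr, hCa, Nat.mul_pos (by omega) hm, hC1, hC2, hC3, hC4, ⟨?_⟩⟩
    exact φ.trans (ψ.mapMatrix.trans
      ((Matrix.compAlgEquiv (Fin n) (Fin m) C K).trans
        (Matrix.reindexAlgEquiv K C finProdFinEquiv)))

theorem theorem1p2 (k : Type u) (K : Type v) (A : Type w) [Field k] [Field K] [Algebra k K]
    [Ring A] [Algebra K A] [Algebra k A] [IsScalarTower k K A]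
    [FiniteDimensional K A] [Algebra.IsCentral K A] [IsSimpleRing A] :
    (FiniteDimensional k K → IsRadicalOver k K A → IsGeneratedBySupersolvable k A) ∧
    (IsGeneratedBySupersolvable k A →
      ∃ (n : ℕ) (C : Type w) (_ : Ring C) (_ : Algebra K C),
        0 < n ∧ FiniteDimensional K C ∧ Algebra.IsCentral K C ∧ IsSimpleRing C ∧
          IsRadicalAbelianOver k K C ∧ Nonempty (A ≃ₐ[K] Matrix (Fin n) (Fin n) C)) :=
  ⟨fun _ h => h.isGeneratedBySupersolvable,
    fun h => IsGeneratedBySupersolvable.exists_matrix_radicalAbelian _ A rfl h⟩
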